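/- **Setting.** A well-defined stochastic HYPE model consists of a finite set $\mathcal V$ of real variables; influence names $\mathit{IN}$ with a map $\mathit{iv}:\mathit{IN}\to\mathcal V$; influence types $I\in\mathit{IT}$, each interpreted as a function $[\![I]\!]:\mathbb R^{\mathcal V}\to\mathbb R$; finite disjoint sets $\mathcal E_d,\mathcal E_s$ of instantaneous and stochastic events, $\mathcal E=\mathcal E_d\cup\mathcal E_s$, with a distinguished $\mathit{init}\in\mathcal E_d$; for $a\in\mathcal E_d$ a guard $\mathit{act}(a)\subseteq\mathbb R^{\mathcal V}$ ($\mathit{act}(\mathit{init})=\mathrm{true}$), for $a\in\mathcal E_s$ a rate $\mathit{act}(a):\mathbb R^{\mathcal V}\to\mathbb R_{\ge0}$; for each $a\in\mathcal E$ a reset $R_a$, a conjunction of at most one atom $V'\sim\theta(\mathcal V)$ per variable, where $\theta$ may contain values drawn from distributions whose parameters are again such expressions; and a controlled system $\mathit{ConSys}=\Sigma\bowtie_L \mathit{init}.\mathit{Con}$, $L$ being the set of all events shared by the two sides. Here $\Sigma=S_1\bowtie_*\cdots\bowtie_* S_s$ ($s\ge1$, cooperation over all shared events, any bracketing) with distinct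 subcomponents $S=\sum_j a_j{:}(\iota,r_j,I_j).S+\mathit{init}{:}(\iota,r,I).S$, the $a_j$ being pairwise distinct and different from $\mathit{init}$; the influence names of $S_1,\dots,S_s$ are in bijection with $\mathit{IN}$. Controllers are given by $\mathit{Con}::=M\mid\mathit{Con}\bowtie_{L'}\mathit{Con}$ with $L'\subseteq\mathcal E$ arbitrary, where $M::=0\mid a.M\mid M+M\mid A$, with finitely many constants $A$ defined by equations $A:=M$. The events of $\Sigma$ are those of $\mathit{init}.\mathit{Con}$. A *TDSHA* has a set of modes, a multiset of flows $(q,s,f)$ ($s\in\mathbb R^{\mathcal V}$, $f:\mathbb R^{\mathcal V}\to\mathbb R$), a set of instantaneous transitions (source, target, guard, reset, weight, event in $\mathcal E_d$), a multiset of stochastic transitions (source, target, guard, reset, rate, event in $\mathcal E_s$), an initial mode and an initial reset. It is *valid* if its modes and events are finite, the $f$ are Lipschitz, guards are closed, weights are positive, rates are locally integrable along $C^1$ curves, and stochastic transitions with the same event have the same rate. **SOS mapping.** States are maps $\sigma:\mathit{IN}\to\mathbb R\times\mathit{IT}$. Transitions of configurations $\langle P,\sigma\rangle$ are derived by the usual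 rules: $\langle a{:}(\iota,r,I).P,\sigma\rangle\xrightarrow{a}\langle P,\sigma[\iota\mapsto(r,I)]\rangle$; $\langle a.P,\sigma\rangle\xrightarrow{a}\langle P,\sigma\rangle$; choice; constants; in $P\bowtie_L Q$, interleaving for $a\notin L$, and for $a\in L$ both sides move from $\sigma$, to states $\tau,\tau'$, the new state being $\Gamma(\sigma,\tau,\tau')$, with value at $\iota$ equal to $\tau(\iota)$ if $\sigma(\iota)=\tau'(\iota)$, to $\tau'(\iota)$ if $\sigma(\iota)=\tau(\iota)$, and undefined otherwise. The multiplicity of a transition is its number of derivations. The modes of $\mathcal T_{SOS}(\mathit{ConSys})$ are the configurations reachable from $\mathit{ConSys}$ by an $\mathit{init}$ transition followed by any transitions. The initial mode is the configuration $\langle P_0,\sigma_0\rangle$ reached by $\mathit{init}$, the initial reset $R_{\mathit{init}}$. Each mode $\langle P,\sigma\rangle$ and $\iota\in\mathit{IN}$ with $\sigma(\iota)=(r,I)$ gives one flow $(\langle P,\sigma\rangle,\mathbf 1_{\mathit{iv}(\iota)},r[\![I]\!])$. Transitions by $a\in\mathcal E_d$ give instantaneous transitions with guard $\mathit{act}(a)$,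 reset $R_a$, weight $1$ (without multiplicity), and those by $a\in\mathcal E_s$ give stochastic transitions with guard true, reset $R_a$, rate $\mathit{act}(a)$ (with multiplicity). **Compositional mapping.** The product $\mathcal T_1\otimes_L\mathcal T_2$ has pairs of modes; in mode $(q_1,q_2)$ the multiset sum of the flows of $q_1$ and $q_2$; each transition with event outside $L$ of one factor, the other staying in any mode; for events in $L$ all pairs of transitions with the same event (and, if stochastic, the same rate), with conjunction of guards and of resets and minimum of weights (sets for instantaneous, multisets for stochastic transitions); and the conjunction of the initial resets. It is defined for reset- and init-compatible factors: conjunctions of resets of same-event transitions of the same kind, and of initial resets, assign no variable two different expressions and draw no random variable from two distributions. $\mathcal T(S)$ has a mode for each activity $\alpha=(\iota,r,I)$ occurring in $S$, with the single flow $(\alpha,\mathbf 1_{\mathit{iv}(\iota)},r[\![I]\!])$; for each mode $\alpha_1$ and summand $a{:}\alpha_2.S$ (including that of $\mathit{init}$) a transition $\alpha_1\to\alpha_2$ with event $a$, guard and reset true, and weight $1$ or rate $\mathit{act}(a)$; its initial mode is the activity of $\mathit{init}$ and its initial reset is true. $\mathcal T(M)$ has the derivatives of $M$ as modes, no flows,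 a transition $M_1\to M_2$ for each occurrence of $a.M_2$ as a summand of $M_1$, with reset $R_a$, and guard $\mathit{act}(a)$ and weight $1$ if $a\in\mathcal E_d$, guard true and rate $\mathit{act}(a)$ if $a\in\mathcal E_s$; its initial mode is $M$ and its initial reset $R_{\mathit{init}}$. $\mathcal T(\Sigma)$ and $\mathcal T(\mathit{Con})$ are the products along the cooperations in $\Sigma$ and $\mathit{Con}$, with the same synchronisation sets, and $\mathcal T(\mathit{ConSys})=\mathcal T(\Sigma)\otimes_L\mathcal T(\mathit{Con})$. **Theorem.** For every well-defined stochastic HYPE model, all products in $\mathcal T(\mathit{ConSys})$ are products of compatible TDSHAs; there is a unique configuration $\langle P_0,\sigma_0\rangle$ reached from $\mathit{ConSys}$ by $\mathit{init}$, and it does not depend on the state before $\mathit{init}$; and, after removal of all modes not reachable from the initial mode in the graph of instantaneous and stochastic transitions, $$\mathcal T(\mathit{ConSys})=\mathcal T_{SOS}(\mathit{ConSys})$$ up to a renaming of modes: there is a bijection $\rho$ from the modes of $\mathcal T_{SOS}(\mathit{ConSys})$ to those of $\mathcal T(\mathit{ConSys})$ that preserves the initial mode and initial reset, the multiset of flows,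 the set of instantaneous transitions (with guards, resets, weights and events) and the multiset of stochastic transitions (with guards, resets, rates, events and multiplicities). It maps $\langle\Sigma\bowtie_L\mathit{Con}',\sigma\rangle$ to the mode made up of the activities $(\iota,r,I)$ with $\sigma(\iota)=(r,I)$ and of the sequential components of $\mathit{Con}'$. If moreover all $[\![I]\!]$ are Lipschitz, all guards closed and all rates locally integrable along $C^1$ curves, then both TDSHAs are valid. -/

import Mathlib

universe u

namespace SHYPE

noncomputable section

/-! ## Multisets and resets -/

/-- A multiset of elements of `α`, presented as an indexed family: the multiplicity of `x` is the
number of indices `i` with `elem i = x`. -/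
structure MSet (α : Type u) : Type (u + 1) where
  Idx : Type u
  elem : Idx → α

/-- Equality of multisets: every element has the same multiplicity on both sides, i.e. the indices
are in an element-preserving bijection. -/
def MSet.Same {α : Type u} (s t : MSet α) : Prop :=
  ∃ e : s.Idx ≃ t.Idx, ∀ i, t.elem (e i) = s.elem i

def MSet.map {α β : Type u} (f : α → β) (s : MSet α) : MSet β :=
  ⟨s.Idx, fun i => f (s.elem i)⟩

/-- A reset over the variables `X`, with names for random variables drawn from `W`: a conjunction
of atoms `x' = r(X, W)`, together with the distribution from which each random variable that it
mentions is drawn (the distribution may have parameters that depend on the current values of the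
variables and of other random variables). Variables that are the target of no atom are unchanged. -/
@[ext]
structure Reset (X W : Type u) : Type u where
  atoms : Set (X × ((X → ℝ) → (W → ℝ) → ℝ))
  laws : Set (W × ((X → ℝ) → (W → ℝ) → MeasureTheory.ProbabilityMeasure ℝ))

namespace Reset

variable {X W : Type u}

/-- The reset `true`: the identity on every variable. -/
def tt : Reset X W := ⟨∅, ∅⟩

/-- Conjunction of resets. -/
def conj (R S : Reset X W) : Reset X W := ⟨R.atoms ∪ S.atoms, R.laws ∪ S.laws⟩

/-- The reset does not set one variable in two ways, and does not draw one random variable from two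
distributions. -/
def Consistent (R : Reset X W) : Prop :=
  (∀ x f g, (x, f) ∈ R.atoms → (x, g) ∈ R.atoms → f = g) ∧
  (∀ w μ ν, (w, μ) ∈ R.laws → (w, ν) ∈ R.laws → μ = ν)

end Reset

/-! ## Transition-driven stochastic hybrid automata -/

/-- A continuous transition `(q, s, f)`. -/
structure FlowTrans (Q X : Type u) : Type u where
  mode : Q
  vec : X → ℝ
  fn : (X → ℝ) → ℝ

/-- An instantaneous transition. The guard is given by the set of points where it holds. -/
structure InstTrans (Q X Ed W : Type u) : Type u where
  src : Q
  tgt : Q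
  guard : Set (X → ℝ)
  reset : Reset X W
  weight : ℝ
  event : Ed

/-- A stochastic transition. -/
structure StochTrans (Q X Es W : Type u) : Type u where
  src : Q
  tgt : Q
  guard : Set (X → ℝ)
  reset : Reset X W
  rate : (X → ℝ) → NNReal
  event : Es

def FlowTrans.map {Q Q' X : Type u} (f : Q → Q') (t : FlowTrans Q X) : FlowTrans Q' X :=
  ⟨f t.mode, t.vec, t.fn⟩

def InstTrans.map {Q Q' X Ed W : Type u} (f : Q → Q') (t : InstTrans Q X Ed W) :
    InstTrans Q' X Ed W :=
  ⟨f t.src, f t.tgt, t.guard, t.reset, t.weight, t.event⟩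

def StochTrans.map {Q Q' X Es W : Type u} (f : Q → Q') (t : StochTrans Q X Es W) :
    StochTrans Q' X Es W :=
  ⟨f t.src, f t.tgt, t.guard, t.reset, t.rate, t.event⟩

/-- The data of a TDSHA with variables `X`, instantaneous events `Ed`, stochastic events `Es` and
names of random variables `W`. The requirements on these data are in `TDSHA.IsValid`. -/
structure TDSHA (X Ed Es W : Type u) : Type (u + 1) where
  Mode : Type u
  flows : MSet (FlowTrans Mode X)
  inst : Set (InstTrans Mode X Ed W)
  stoch : MSet (StochTrans Mode X Es W)
  initMode : Mode
  initReset : Reset X W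

/-- The rate function `f` is locally integrable along every continuously differentiable curve. -/
def IntegrableAlongCurves {X : Type u} [Fintype X] (f : (X → ℝ) → NNReal) : Prop :=
  ∀ γ : ℝ → X → ℝ, ContDiff ℝ 1 γ →
    MeasureTheory.LocallyIntegrable (fun t => (f (γ t) : ℝ)) MeasureTheory.volume

namespace TDSHA

variable {X Ed Es W : Type u}

/-- The requirements in the definition of a TDSHA. -/
structure IsValid [Fintype X] (T : TDSHA X Ed Es W) : Prop where
  finite_modes : Finite T.Mode
  finite_events : Finite (Ed ⊕ Es)
  lipschitz : ∀ i, ∃ C, LipschitzWith C (T.flows.elem i).fn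
  inst_closed : ∀ δ ∈ T.inst, IsClosed δ.guard
  weight_pos : ∀ δ ∈ T.inst, 0 < δ.weight
  stoch_closed : ∀ i, IsClosed (T.stoch.elem i).guard
  integrable : ∀ i, IntegrableAlongCurves (T.stoch.elem i).rate
  consistent : ∀ i j, (T.stoch.elem i).event = (T.stoch.elem j).event →
    (T.stoch.elem i).rate = (T.stoch.elem j).rate

/-- Two TDSHA are reset-compatible: transitions of the same kind that carry the same event never
have clashing resets. -/
def ResetCompatible (T₁ T₂ : TDSHA X Ed Es W) : Prop :=
  (∀ δ₁ ∈ T₁.inst, ∀ δ₂ ∈ T₂.inst, δ₁.event = δ₂.event →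
    (δ₁.reset.conj δ₂.reset).Consistent) ∧
  (∀ i j, (T₁.stoch.elem i).event = (T₂.stoch.elem j).event →
    ((T₁.stoch.elem i).reset.conj (T₂.stoch.elem j).reset).Consistent)

/-- Two TDSHA are init-compatible: their initial conditions do not clash. -/
def InitCompatible (T₁ T₂ : TDSHA X Ed Es W) : Prop :=
  (T₁.initReset.conj T₂.initReset).Consistent

/-- The product `T₁ ⊗_L T₂` of two TDSHA over the same variables and the same events. -/
def tprod (L : Set (Ed ⊕ Es)) (T₁ T₂ : TDSHA X Ed Es W) : TDSHA X Ed Es W where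
  Mode := T₁.Mode × T₂.Mode
  flows :=
    { Idx := (T₁.flows.Idx × T₂.Mode) ⊕ (T₁.Mode × T₂.flows.Idx)
      elem := Sum.elim
        (fun p => (T₁.flows.elem p.1).map fun q => (q, p.2))
        (fun p => (T₂.flows.elem p.2).map fun q => (p.1, q)) }
  inst :=
    {δ | ∃ δ₁ ∈ T₁.inst, ∃ q₂ : T₂.Mode, Sum.inl δ₁.event ∉ L ∧ δ = δ₁.map fun q => (q, q₂)} ∪
    {δ | ∃ δ₂ ∈ T₂.inst, ∃ q₁ : T₁.Mode, Sum.inl δ₂.event ∉ L ∧ δ = δ₂.map fun q => (q₁, q)} ∪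
    {δ | ∃ δ₁ ∈ T₁.inst, ∃ δ₂ ∈ T₂.inst, δ₁.event = δ₂.event ∧ Sum.inl δ₁.event ∈ L ∧
      δ = ⟨(δ₁.src, δ₂.src), (δ₁.tgt, δ₂.tgt), δ₁.guard ∩ δ₂.guard, δ₁.reset.conj δ₂.reset,
        min δ₁.weight δ₂.weight, δ₁.event⟩}
  stoch :=
    { Idx :=
        ({i : T₁.stoch.Idx // Sum.inr (T₁.stoch.elem i).event ∉ L} × T₂.Mode) ⊕
        (T₁.Mode × {j : T₂.stoch.Idx // Sum.inr (T₂.stoch.elem j).event ∉ L}) ⊕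
        {p : T₁.stoch.Idx × T₂.stoch.Idx //
          (T₁.stoch.elem p.1).event = (T₂.stoch.elem p.2).event ∧
          (T₁.stoch.elem p.1).rate = (T₂.stoch.elem p.2).rate ∧
          Sum.inr (T₁.stoch.elem p.1).event ∈ L}
      elem := Sum.elim
        (fun p => (T₁.stoch.elem p.1.1).map fun q => (q, p.2))
        (Sum.elim
          (fun p => (T₂.stoch.elem p.2.1).map fun q => (p.1, q))
          (fun p =>
            let η₁ := T₁.stoch.elem p.1.1
            let η₂ := T₂.stoch.elem p.1.2
            ⟨(η₁.src, η₂.src), (η₁.tgt, η₂.tgt), η₁.guard ∩ η₂.guard, η₁.reset.conj η₂.reset,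
              η₁.rate, η₁.event⟩)) }
  initMode := (T₁.initMode, T₂.initMode)
  initReset := T₁.initReset.conj T₂.initReset

/-- Reachability in the graph of discrete (instantaneous and stochastic) transitions. -/
inductive Reachable (T : TDSHA X Ed Es W) : T.Mode → Prop
  | init : Reachable T T.initMode
  | inst (δ : InstTrans T.Mode X Ed W) : δ ∈ T.inst → Reachable T δ.src → Reachable T δ.tgt
  | stoch (i : T.stoch.Idx) : Reachable T (T.stoch.elem i).src → Reachable T (T.stoch.elem i).tgt

/-- The TDSHA obtained by removing all unreachable modes. -/
def prune (T : TDSHA X Ed Es W) : TDSHA X Ed Es W where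
  Mode := {q : T.Mode // T.Reachable q}
  flows :=
    { Idx := {i : T.flows.Idx // T.Reachable (T.flows.elem i).mode}
      elem := fun i => ⟨⟨(T.flows.elem i.1).mode, i.2⟩, (T.flows.elem i.1).vec,
        (T.flows.elem i.1).fn⟩ }
  inst := {δ | δ.map Subtype.val ∈ T.inst}
  stoch :=
    { Idx := {i : T.stoch.Idx //
        T.Reachable (T.stoch.elem i).src ∧ T.Reachable (T.stoch.elem i).tgt}
      elem := fun i =>
        let η := T.stoch.elem i.1
        ⟨⟨η.src, i.2.1⟩, ⟨η.tgt, i.2.2⟩, η.guard, η.reset, η.rate, η.event⟩ }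
  initMode := ⟨T.initMode, Reachable.init⟩
  initReset := T.initReset

/-- `T` and `T'` are the same TDSHA up to the renaming `modes` of modes: the renaming preserves the
initial state, the multiset of flows, the set of instantaneous transitions and the multiset of
stochastic transitions, with all labels. -/
structure Iso (T T' : TDSHA X Ed Es W) where
  modes : T.Mode ≃ T'.Mode
  initMode : modes T.initMode = T'.initMode
  initReset : T.initReset = T'.initReset
  flows : (T.flows.map (FlowTrans.map modes)).Same T'.flows
  inst : (InstTrans.map modes) '' T.inst = T'.inst
  stoch : (T.stoch.map (StochTrans.map modes)).Same T'.stoch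

end TDSHA

/-! ## Syntax of stochastic HYPE -/

/-- An activity `(ι, r, I)`. -/
structure Activity (IN IT : Type u) : Type u where
  name : IN
  strength : ℝ
  kind : IT

/-- Process terms over events `E`, activities `A` and constants `C`. -/
inductive Term (E A C : Type u) : Type u
  | nil : Term E A C
  | pre : E → Term E A C → Term E A C
  | ipre : E → A → Term E A C → Term E A C
  | choice : Term E A C → Term E A C → Term E A C
  | coop : Set E → Term E A C → Term E A C → Term E A C
  | const : C → Term E A C

/-- Sequential controllers, `M ::= a.M | 0 | M + M`, with recursion through constants in `K`. -/
inductive Seq (E K : Type u) : Type u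
  | nil : Seq E K
  | pre : E → Seq E K → Seq E K
  | sum : Seq E K → Seq E K → Seq E K
  | const : K → Seq E K

/-- Controllers, `Con ::= M | Con ⋈_L Con`. -/
inductive Ctrl (E K : Type u) : Type u
  | seq : Seq E K → Ctrl E K
  | coop : Set E → Ctrl E K → Ctrl E K → Ctrl E K

/-- Uncontrolled systems: subcomponents (given by their names) in cooperation over all shared
events, with an arbitrary bracketing. -/
inductive USys (SN : Type u) : Type u
  | sub : SN → USys SN
  | coop : USys SN → USys SN → USys SN

/-- The right-hand side `∑ⱼ aⱼ:(ι,rⱼ,Iⱼ).S + init:(ι,r,I).S` of the definition of a subcomponent: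
its influence name, its branches `(aⱼ, rⱼ, Iⱼ)`, and the pair `(r, I)` for `init`. -/
structure Subcomp (E IN IT : Type u) : Type u where
  infl : IN
  branches : List (E × ℝ × IT)
  initial : ℝ × IT

/-- Expressions `θ(𝒱)` on the right-hand side of a reset: built from variables by real functions
and by random values `𝒳(p₁,…,pₘ)` drawn from a distribution whose parameters are expressions. -/
inductive RExpr (V : Type u) : Type u
  | var : V → RExpr V
  | app (n : ℕ) (f : (Fin n → ℝ) → ℝ) (args : Fin n → RExpr V) : RExpr V
  | rand (n : ℕ) (dist : (Fin n → ℝ) → MeasureTheory.ProbabilityMeasure ℝ)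
      (params : Fin n → RExpr V) : RExpr V

/-- The value of an expression, read at position `p`, in which every random value is replaced by
a random variable of its own, named by the position of the random value. -/
def RExpr.eval {V : Type u} : RExpr V → List ℕ → (V → ℝ) → (List ℕ → ℝ) → ℝ
  | .var v, _, x, _ => x v
  | .app _ f args, p, x, w => f fun i => (args i).eval ((i : ℕ) :: p) x w
  | .rand _ _ _, p, _, w => w p

/-- The random variables of an expression, with the distributions from which they are drawn. -/
def RExpr.laws {V : Type u} : RExpr V → List ℕ →
    Set (List ℕ × ((V → ℝ) → (List ℕ → ℝ) → MeasureTheory.ProbabilityMeasure ℝ))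
  | .var _, _ => ∅
  | .app _ _ args, p => ⋃ i, (args i).laws ((i : ℕ) :: p)
  | .rand _ dist params, p =>
      {(p, fun x w => dist fun i => (params i).eval ((i : ℕ) :: p) x w)} ∪
        ⋃ i, (params i).laws ((i : ℕ) :: p)

/-- A stochastic HYPE model with variables `V`, influence names `IN`, influence types `IT`,
instantaneous events `Ed`, stochastic events `Es`, names of subcomponents `SN` and constants `K` for
sequential controllers. Its controlled system is `sys ⋈ init.con` (see `Model.conSys`). -/
structure Model (V IN IT Ed Es SN K : Type u) : Type u where
  /-- the initial event -/
  init : Ed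
  /-- the definitions of the subcomponents -/
  sub : SN → Subcomp (Ed ⊕ Es) IN IT
  /-- the definitions of the controller constants -/
  body : K → Seq (Ed ⊕ Es) K
  /-- the uncontrolled system -/
  sys : USys SN
  /-- the controller -/
  con : Ctrl (Ed ⊕ Es) K
  /-- activation conditions of instantaneous events -/
  guard : Ed → Set (V → ℝ)
  /-- activation conditions (rates) of stochastic events -/
  rate : Es → (V → ℝ) → NNReal
  /-- resets: the conjunction of the atoms `v ∼ θ` with `res a v = some θ` -/
  res : Ed ⊕ Es → V → Option (RExpr V)
  /-- the variable affected by an influence -/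
  iv : IN → V
  /-- the interpretation of influence types -/
  interp : IT → (V → ℝ) → ℝ

/-- Embedding of sequential controllers into process terms. -/
def Seq.toTerm {E K : Type u} (A SN : Type u) : Seq E K → Term E A (SN ⊕ K)
  | .nil => .nil
  | .pre a M => .pre a (M.toTerm A SN)
  | .sum M N => .choice (M.toTerm A SN) (N.toTerm A SN)
  | .const k => .const (Sum.inr k)

/-- Embedding of controllers into process terms. -/
def Ctrl.toTerm {E K : Type u} (A SN : Type u) : Ctrl E K → Term E A (SN ⊕ K)
  | .seq M => M.toTerm A SN
  | .coop L C D => .coop L (C.toTerm A SN) (D.toTerm A SN)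

/-- The names of the subcomponents of an uncontrolled system. -/
def USys.leaves {SN : Type u} : USys SN → List SN
  | .sub s => [s]
  | .coop U U' => U.leaves ++ U'.leaves

/-- `a.M'` occurs as a summand of `M = ∑ᵢ aᵢ.Mᵢ` (constants being replaced by their definitions);
the elements of the type are the occurrences. -/
inductive Summand {E K : Type u} (body : K → Seq E K) : Seq E K → E → Seq E K → Type u
  | pre (a : E) (M : Seq E K) : Summand body (.pre a M) a M
  | left {M N M' : Seq E K} {a : E} : Summand body M a M' → Summand body (.sum M N) a M'
  | right {M N N' : Seq E K} {a : E} : Summand body N a N' → Summand body (.sum M N) a N'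
  | const {k : K} {M' : Seq E K} {a : E} :
      Summand body (body k) a M' → Summand body (.const k) a M'

/-- The derivative set of a sequential controller `M = ∑ᵢ aᵢ.Mᵢ`, the least set with
`ds(M) = {M} ∪ ⋃ᵢ ds(Mᵢ)`. -/
inductive SeqDs {E K : Type u} (body : K → Seq E K) (M : Seq E K) : Seq E K → Prop
  | refl : SeqDs body M M
  | step {M₁ M₂ : Seq E K} {a : E} :
      SeqDs body M M₁ → Nonempty (Summand body M₁ a M₂) → SeqDs body M M₂

/-- The event `a` occurs in a sequential controller (constants being replaced by their
definitions). -/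
inductive Seq.Occurs {E K : Type u} (body : K → Seq E K) (a : E) : Seq E K → Prop
  | head (M : Seq E K) : Occurs body a (.pre a M)
  | tail {M : Seq E K} (b : E) : Occurs body a M → Occurs body a (.pre b M)
  | left {M : Seq E K} (N : Seq E K) : Occurs body a M → Occurs body a (.sum M N)
  | right (M : Seq E K) {N : Seq E K} : Occurs body a N → Occurs body a (.sum M N)
  | const {k : K} : Occurs body a (body k) → Occurs body a (.const k)

/-- The set of events of a controller. -/
def Ctrl.ev {E K : Type u} (body : K → Seq E K) : Ctrl E K → Set E
  | .seq M => {a | M.Occurs body a}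
  | .coop _ C D => C.ev body ∪ D.ev body

/-! ## Operational semantics -/

/-- Operational states. -/
abbrev State (IN IT : Type u) : Type u := IN → ℝ × IT

open Classical in
/-- The updated state `σ[ι ↦ (r, I)]`. -/
def State.upd {IN IT : Type u} (σ : State IN IT) (α : Activity IN IT) : State IN IT :=
  fun x => if x = α.name then (α.strength, α.kind) else σ x

/-- `Γ(σ, τ, τ')` is defined and equal to `υ`. -/
def IsGamma {IN IT : Type u} (σ τ τ' υ : State IN IT) : Prop :=
  ∀ x, (σ x = τ' x ∧ υ x = τ x) ∨ (σ x = τ x ∧ υ x = τ' x)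

/-- The labelled multitransition system: the elements of `Step env P σ a P' σ'` are the derivations
of `⟨P, σ⟩ -a→ ⟨P', σ'⟩`, so that their number is the multiplicity of this transition. -/
inductive Step {E IN IT C : Type u} (env : C → Term E (Activity IN IT) C) :
    Term E (Activity IN IT) C → State IN IT → E →
    Term E (Activity IN IT) C → State IN IT → Type u
  | ipre {a : E} {α : Activity IN IT} {P : Term E (Activity IN IT) C} {σ σ' : State IN IT}
      (h : σ' = σ.upd α) : Step env (.ipre a α P) σ a P σ'
  | pre {a : E} {P : Term E (Activity IN IT) C} {σ : State IN IT} :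
      Step env (.pre a P) σ a P σ
  | left {P Q P' : Term E (Activity IN IT) C} {σ σ' : State IN IT} {a : E} :
      Step env P σ a P' σ' → Step env (.choice P Q) σ a P' σ'
  | right {P Q Q' : Term E (Activity IN IT) C} {σ σ' : State IN IT} {a : E} :
      Step env Q σ a Q' σ' → Step env (.choice P Q) σ a Q' σ'
  | const {c : C} {P' : Term E (Activity IN IT) C} {σ σ' : State IN IT} {a : E} :
      Step env (env c) σ a P' σ' → Step env (.const c) σ a P' σ'
  | coopLeft {L : Set E} {P Q P' : Term E (Activity IN IT) C} {σ σ' : State IN IT} {a : E}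
      (h : a ∉ L) : Step env P σ a P' σ' → Step env (.coop L P Q) σ a (.coop L P' Q) σ'
  | coopRight {L : Set E} {P Q Q' : Term E (Activity IN IT) C} {σ σ' : State IN IT} {a : E}
      (h : a ∉ L) : Step env Q σ a Q' σ' → Step env (.coop L P Q) σ a (.coop L P Q') σ'
  | coopSync {L : Set E} {P Q P' Q' : Term E (Activity IN IT) C} {σ τ τ' υ : State IN IT} {a : E}
      (h : a ∈ L) : Step env P σ a P' τ → Step env Q σ a Q' τ' → IsGamma σ τ τ' υ →
      Step env (.coop L P Q) σ a (.coop L P' Q') υ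

namespace Subcomp

variable {E IN IT : Type u}

/-- The activity with the influence name of `S` and the given strength and type. -/
def act (S : Subcomp E IN IT) (p : ℝ × IT) : Activity IN IT := ⟨S.infl, p.1, p.2⟩

/-- The list of all pairs `(a, α)` for which `a:α.S` is a summand of `S`. -/
def prefixes (init : E) (S : Subcomp E IN IT) : List (E × Activity IN IT) :=
  S.branches.map (fun b => (b.1, S.act b.2)) ++ [(init, S.act S.initial)]

/-- The right-hand side of the definition of the subcomponent named `c`. -/
def toTerm {C : Type u} (init : E) (S : Subcomp E IN IT) (c : C) : Term E (Activity IN IT) C :=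
  S.branches.foldr (fun b P => .choice (.ipre b.1 (S.act b.2) (.const c)) P)
    (.ipre init (S.act S.initial) (.const c))

end Subcomp

namespace Model

variable {V IN IT Ed Es SN K : Type u}

/-- The set of events of an uncontrolled system. -/
def uev (M : Model V IN IT Ed Es SN K) : USys SN → Set (Ed ⊕ Es)
  | .sub s => {a | ∃ α, (a, α) ∈ (M.sub s).prefixes (Sum.inl M.init)}
  | .coop U U' => M.uev U ∪ M.uev U'

/-- The process term of an uncontrolled system: cooperation over all shared events. -/
def uterm (M : Model V IN IT Ed Es SN K) :
    USys SN → Term (Ed ⊕ Es) (Activity IN IT) (SN ⊕ K)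
  | .sub s => .const (Sum.inl s)
  | .coop U U' => .coop (M.uev U ∩ M.uev U') (M.uterm U) (M.uterm U')

/-- The definitions of all constants. -/
def env (M : Model V IN IT Ed Es SN K) : SN ⊕ K → Term (Ed ⊕ Es) (Activity IN IT) (SN ⊕ K)
  | .inl s => (M.sub s).toTerm (Sum.inl M.init) (Sum.inl s)
  | .inr k => (M.body k).toTerm (Activity IN IT) SN

/-- The events shared by `sys` and `init.con`. -/
def syncSet (M : Model V IN IT Ed Es SN K) : Set (Ed ⊕ Es) :=
  M.uev M.sys ∩ ({Sum.inl M.init} ∪ M.con.ev M.body)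

/-- The controlled system `sys ⋈ init.con`, synchronised on all shared events. -/
def conSys (M : Model V IN IT Ed Es SN K) : Term (Ed ⊕ Es) (Activity IN IT) (SN ⊕ K) :=
  .coop M.syncSet (M.uterm M.sys)
    (.pre (Sum.inl M.init) (M.con.toTerm (Activity IN IT) SN))

/-- Well-definedness of a stochastic HYPE model (the two-level grammars are built into the types
`Seq`, `Ctrl`, `USys` and `Subcomp`). -/
structure WellDefined (M : Model V IN IT Ed Es SN K) : Prop where
  /-- `init` has activation condition `true` -/
  guard_init : M.guard M.init = Set.univ
  /-- each subcomponent appears at most once -/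
  nodup : M.sys.leaves.Nodup
  /-- the events of a subcomponent are pairwise distinct -/
  distinct : ∀ s ∈ M.sys.leaves, ((M.sub s).branches.map Prod.fst).Nodup
  /-- the non-initial events of a subcomponent differ from `init` -/
  ne_init : ∀ s ∈ M.sys.leaves, Sum.inl M.init ∉ (M.sub s).branches.map Prod.fst
  /-- influences and subcomponents are in one-to-one correspondence -/
  infl : ∀ x : IN, ∃! s, s ∈ M.sys.leaves ∧ (M.sub s).infl = x
  /-- uncontrolled system and controller have the same events -/
  events : M.uev M.sys = {Sum.inl M.init} ∪ M.con.ev M.body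

/-- Configurations. -/
abbrev Config (_M : Model V IN IT Ed Es SN K) : Type u :=
  Term (Ed ⊕ Es) (Activity IN IT) (SN ⊕ K) × State IN IT

/-- The transitions between configurations, with multiplicity. -/
abbrev Trans (M : Model V IN IT Ed Es SN K) (c : M.Config) (a : Ed ⊕ Es) (c' : M.Config) :
    Type u :=
  Step M.env c.1 c.2 a c'.1 c'.2

/-- The derivative set of the controlled system. -/
inductive Ds (M : Model V IN IT Ed Es SN K) : M.Config → Prop
  | init {σ : State IN IT} {c : M.Config} :
      Nonempty (M.Trans (M.conSys, σ) (Sum.inl M.init) c) → Ds M c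
  | step {c c' : M.Config} {a : Ed ⊕ Es} : Ds M c → Nonempty (M.Trans c a c') → Ds M c'

/-- `c₀` is the configuration obtained from the controlled system after the initial event, whatever
the state before that event. -/
def IsInitial (M : Model V IN IT Ed Es SN K) (c₀ : M.Config) : Prop :=
  ∀ σ c, Nonempty (M.Trans (M.conSys, σ) (Sum.inl M.init) c) ↔ c = c₀

theorem IsInitial.ds {M : Model V IN IT Ed Es SN K} {c₀ : M.Config} (h : M.IsInitial c₀) :
    M.Ds c₀ :=
  Ds.init ((h c₀.2 c₀).2 rfl)

/-! ## The two mappings to TDSHA -/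

/-- Names of random variables: the event, the variable that is reset, and the position in the
expression. -/
abbrev RName (V Ed Es : Type u) : Type u := (Ed ⊕ Es) × V × List ℕ

/-- The reset `R_a` of the event `a`. -/
def R (M : Model V IN IT Ed Es SN K) (a : Ed ⊕ Es) : Reset V (RName V Ed Es) where
  atoms := {p | ∃ θ, M.res a p.1 = some θ ∧ p.2 = fun x w => θ.eval [] x fun l => w (a, p.1, l)}
  laws := {p | ∃ v θ l μ, M.res a v = some θ ∧ (l, μ) ∈ θ.laws [] ∧
    p = ((a, v, l), fun x w => μ x fun l' => w (a, v, l'))}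

open Classical in
/-- The unit vector of the variable `v`. -/
def unitVec (v : V) : V → ℝ := fun x => if x = v then 1 else 0

/-- The function `r · ⟦I⟧`. -/
def flowFn (M : Model V IN IT Ed Es SN K) (r : ℝ) (I : IT) : (V → ℝ) → ℝ :=
  fun x => r * M.interp I x

/-- The SOS mapping: the TDSHA obtained from the labelled multitransition system. -/
def tdshaSOS (M : Model V IN IT Ed Es SN K) (c₀ : M.Config) (h₀ : M.IsInitial c₀) :
    TDSHA V Ed Es (RName V Ed Es) where
  Mode := {c : M.Config // M.Ds c}
  flows :=
    { Idx := {c : M.Config // M.Ds c} × IN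
      elem := fun p => ⟨p.1, unitVec (M.iv p.2), M.flowFn (p.1.1.2 p.2).1 (p.1.1.2 p.2).2⟩ }
  inst := {δ | ∃ (c c' : {c : M.Config // M.Ds c}) (a : Ed),
    Nonempty (M.Trans c.1 (Sum.inl a) c'.1) ∧
    δ = ⟨c, c', M.guard a, M.R (Sum.inl a), 1, a⟩}
  stoch :=
    { Idx := Σ (c c' : {c : M.Config // M.Ds c}) (a : Es), M.Trans c.1 (Sum.inr a) c'.1
      elem := fun t => ⟨t.1, t.2.1, Set.univ, M.R (Sum.inr t.2.2.1), M.rate t.2.2.1, t.2.2.1⟩ }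
  initMode := ⟨c₀, h₀.ds⟩
  initReset := M.R (Sum.inl M.init)

/-- The activities of the subcomponent named `s`. -/
def acts (M : Model V IN IT Ed Es SN K) (s : SN) : Set (Activity IN IT) :=
  {α | ∃ a, (a, α) ∈ (M.sub s).prefixes (Sum.inl M.init)}

theorem initial_mem_acts (M : Model V IN IT Ed Es SN K) (s : SN) :
    (M.sub s).act (M.sub s).initial ∈ M.acts s :=
  ⟨Sum.inl M.init, List.mem_append_right _ (List.mem_singleton.2 rfl)⟩

/-- The TDSHA of a subcomponent: one mode for each of its activities. -/
def tdshaSub (M : Model V IN IT Ed Es SN K) (s : SN) : TDSHA V Ed Es (RName V Ed Es) where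
  Mode := {α // α ∈ M.acts s}
  flows :=
    { Idx := {α // α ∈ M.acts s}
      elem := fun α => ⟨α, unitVec (M.iv α.1.name), M.flowFn α.1.strength α.1.kind⟩ }
  inst := {δ | ∃ (α₁ α₂ : {α // α ∈ M.acts s}) (a : Ed),
    (Sum.inl a, α₂.1) ∈ (M.sub s).prefixes (Sum.inl M.init) ∧
    δ = ⟨α₁, α₂, Set.univ, Reset.tt, 1, a⟩}
  stoch :=
    { Idx := {t : {α // α ∈ M.acts s} × {α // α ∈ M.acts s} × Es //
        (Sum.inr t.2.2, t.2.1.1) ∈ (M.sub s).prefixes (Sum.inl M.init)}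
      elem := fun t => ⟨t.1.1, t.1.2.1, Set.univ, Reset.tt, M.rate t.1.2.2, t.1.2.2⟩ }
  initMode := ⟨(M.sub s).act (M.sub s).initial, M.initial_mem_acts s⟩
  initReset := Reset.tt

/-- The TDSHA of an uncontrolled system. -/
def tdshaU (M : Model V IN IT Ed Es SN K) : USys SN → TDSHA V Ed Es (RName V Ed Es)
  | .sub s => M.tdshaSub s
  | .coop U U' => TDSHA.tprod (M.uev U ∩ M.uev U') (M.tdshaU U) (M.tdshaU U')

/-- The TDSHA of a sequential controller: one mode for each derivative. -/
def tdshaSeq (M : Model V IN IT Ed Es SN K) (N : Seq (Ed ⊕ Es) K) :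
    TDSHA V Ed Es (RName V Ed Es) where
  Mode := {N' // SeqDs M.body N N'}
  flows := ⟨PEmpty, PEmpty.elim⟩
  inst := {δ | ∃ (N₁ N₂ : {N' // SeqDs M.body N N'}) (a : Ed),
    Nonempty (Summand M.body N₁.1 (Sum.inl a) N₂.1) ∧
    δ = ⟨N₁, N₂, M.guard a, M.R (Sum.inl a), 1, a⟩}
  stoch :=
    { Idx := Σ (N₁ N₂ : {N' // SeqDs M.body N N'}) (a : Es),
        Summand M.body N₁.1 (Sum.inr a) N₂.1
      elem := fun t => ⟨t.1, t.2.1, Set.univ, M.R (Sum.inr t.2.2.1), M.rate t.2.2.1, t.2.2.1⟩ }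
  initMode := ⟨N, SeqDs.refl⟩
  initReset := M.R (Sum.inl M.init)

/-- The TDSHA of a controller. -/
def tdshaC (M : Model V IN IT Ed Es SN K) : Ctrl (Ed ⊕ Es) K → TDSHA V Ed Es (RName V Ed Es)
  | .seq N => M.tdshaSeq N
  | .coop L C D => TDSHA.tprod L (M.tdshaC C) (M.tdshaC D)

/-- The compositional mapping. -/
def tdshaComp (M : Model V IN IT Ed Es SN K) : TDSHA V Ed Es (RName V Ed Es) :=
  TDSHA.tprod M.syncSet (M.tdshaU M.sys) (M.tdshaC M.con)

/-- All products in the TDSHA of an uncontrolled system have compatible factors. -/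
def ProductsDefinedU (M : Model V IN IT Ed Es SN K) : USys SN → Prop
  | .sub _ => True
  | .coop U U' => M.ProductsDefinedU U ∧ M.ProductsDefinedU U' ∧
      (M.tdshaU U).ResetCompatible (M.tdshaU U') ∧ (M.tdshaU U).InitCompatible (M.tdshaU U')

/-- All products in the TDSHA of a controller have compatible factors. -/
def ProductsDefinedC (M : Model V IN IT Ed Es SN K) : Ctrl (Ed ⊕ Es) K → Prop
  | .seq _ => True
  | .coop _ C D => M.ProductsDefinedC C ∧ M.ProductsDefinedC D ∧
      (M.tdshaC C).ResetCompatible (M.tdshaC D) ∧ (M.tdshaC C).InitCompatible (M.tdshaC D)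

/-- All products in the compositional mapping have reset-compatible and init-compatible factors,
as the definition of the product requires. -/
def ProductsDefined (M : Model V IN IT Ed Es SN K) : Prop :=
  M.ProductsDefinedU M.sys ∧ M.ProductsDefinedC M.con ∧
  (M.tdshaU M.sys).ResetCompatible (M.tdshaC M.con) ∧
  (M.tdshaU M.sys).InitCompatible (M.tdshaC M.con)

/-- The activity `α` is active in the mode `q` of the TDSHA of an uncontrolled system. -/
def Active (M : Model V IN IT Ed Es SN K) :
    (U : USys SN) → (M.tdshaU U).Mode → Activity IN IT → Prop
  | .sub _, q, α => α = q.1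
  | .coop U U', q, α => M.Active U q.1 α ∨ M.Active U' q.2 α

/-- The controller that a mode of the TDSHA of a controller stands for. -/
def ctrlOf (M : Model V IN IT Ed Es SN K) :
    (C : Ctrl (Ed ⊕ Es) K) → (M.tdshaC C).Mode → Ctrl (Ed ⊕ Es) K
  | .seq _, q => .seq q.1
  | .coop L C D, q => .coop L (M.ctrlOf C q.1) (M.ctrlOf D q.2)

/-- The configuration `c = ⟨sys ⋈ Con', σ⟩` and the mode `q` of the compositional TDSHA stand for
each other: `q` consists of the activities that make up `σ` and of the sequential components of
`Con'`. -/
def Matches (M : Model V IN IT Ed Es SN K) (c : M.Config) (q : M.tdshaComp.Mode) : Prop :=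
  c.1 = .coop M.syncSet (M.uterm M.sys) ((M.ctrlOf M.con q.2).toTerm (Activity IN IT) SN) ∧
  ∀ x r I, c.2 x = (r, I) ↔ M.Active M.sys q.1 ⟨x, r, I⟩

/-- The analytic requirements on the ingredients of a model that the definition of a TDSHA makes of
its labels. -/
structure Regular [Fintype V] (M : Model V IN IT Ed Es SN K) : Prop where
  lipschitz : ∀ I, ∃ C, LipschitzWith C (M.interp I)
  closed : ∀ a, IsClosed (M.guard a)
  integrable : ∀ a, IntegrableAlongCurves (M.rate a)

end Model

end

end SHYPE

/-!
A controlled system `Σ ⋈ init.Con` and the product `𝒯(Σ) ⊗ 𝒯(Con)` are both labelled transition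
systems in which every label is determined by the event, so only the numbers of transitions between
two modes have to be compared. `TDSHA.Presented` expresses this: a family of types `Tr q a q'`
stands for the transitions of a TDSHA. Presentations are compatible with products
(`TDSHA.Presented.tprod`), with the family `Sync` that has one summand for each of the three rules
for a cooperation.

For the uncontrolled system both sides are deterministic. An event `a` overwrites certain influences
with values that do not depend on the state (`Model.newVal`). Since subcomponents have distinct
influence names, the cooperation of two parts overwrites the influences of one part independently of
those of the other; in particular `Γ` is always defined. Thus a derivation of `Σ` is unique and
given by overwriting (`Model.step_uterm_iff`, `Model.step_uterm_subsingleton`), and so is a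
transition of `𝒯(Σ)` (`Model.presented_tdshaU`), a mode being the partial
function `Model.modeVal` from influence names to values.

Controllers never change the state, and their derivations are in bijection with the transitions of
`𝒯(Con)`: for sequential controllers a derivation is an occurrence of a summand, and for
cooperations the rules match `Sync` (`Model.presented_tdshaC`). Multiplicities of stochastic
transitions come from here alone.

As `Σ` and `init.Con` have the same events, the outer cooperation synchronises every event. Hence
the relation `Model.Corresponds` between configurations and modes is a one-to-one bisimulation that
preserves the number of transitions (`Model.Corresponds.trans_equiv`), and it relates the initial
modes, because `init` overwrites all influences (`Model.WellDefined.exists_isInitial`). Such a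
relation restricts to an isomorphism of the reachable parts (`TDSHA.Presented.exists_prune_iso`).
Compatibility of the factors holds because all resets of an event `a` are `true` or `R_a`, and `R_a`
is consistent: distinct random values of an expression have distinct positions
(`RExpr.laws_unique`).
-/

universe v w

namespace SHYPE

noncomputable section

/-! ### Multisets, presentations of transitions, and products -/

theorem MSet.same_of_fibers {α β : Type u} {s : MSet α} {t : MSet β} (g : α ≃ β)
    (h : ∀ x, Nonempty ({i // s.elem i = x} ≃ {j // t.elem j = g x})) :
    (s.map g).Same t := by
  let e x := (h x).some
  let E : s.Idx ≃ t.Idx :=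
    (Equiv.sigmaFiberEquiv s.elem).symm.trans
      ((Equiv.sigmaCongr g e).trans (Equiv.sigmaFiberEquiv t.elem))
  exact ⟨E, fun i => (e (s.elem i) ⟨i, rfl⟩).2⟩

/-- The elements of a family indexed by source, target and event, with given indices. -/
def sigmaFiberEquiv {Q : Type u} {E : Type v} (Tr : Q → E → Q → Type w) (q : Q) (a : E) (q' : Q) :
    {i : Σ (q q' : Q) (a : E), Tr q a q' // i.1 = q ∧ i.2.1 = q' ∧ i.2.2.1 = a} ≃ Tr q a q' where
  toFun | ⟨⟨_, _, _, t⟩, h₁, h₂, h₃⟩ => h₁ ▸ h₂ ▸ h₃ ▸ t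
  invFun t := ⟨⟨q, q', a, t⟩, rfl, rfl, rfl⟩
  left_inv := by
    rintro ⟨⟨_, _, _, t⟩, rfl, rfl, rfl⟩
    rfl
  right_inv _ := rfl

/-- The transitions with event `a` of a product synchronised on `L`, in terms of the types `A` and
`B` of transitions of the two factors; `p` and `q` say that the second and the first factor,
respectively, stays where it is. -/
def Sync {E : Type w} (L : Set E) (a : E) (A : Type u) (B : Type v) (p q : Prop) : Type (max u v) :=
  {_x : A // a ∉ L ∧ p} ⊕ {_x : B // a ∉ L ∧ q} ⊕ {_x : A × B // a ∈ L}

namespace Sync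

variable {E : Type w} {L : Set E} {a : E} {A : Type u} {B : Type v} {p q : Prop}

/-- Events in `L` only occur synchronised. -/
def equivOfMem (h : a ∈ L) : Sync L a A B p q ≃ A × B where
  toFun
    | .inl x => (x.2.1 h).elim
    | .inr (.inl x) => (x.2.1 h).elim
    | .inr (.inr x) => x.1
  invFun x := .inr (.inr ⟨x, h⟩)
  left_inv := by
    rintro (x | x | x)
    · exact (x.2.1 h).elim
    · exact (x.2.1 h).elim
    · rfl
  right_inv _ := rfl

/-- Events outside `L` only occur interleaved. -/
def equivOfNotMem (h : a ∉ L) : Sync L a A B p q ≃ {_x : A // p} ⊕ {_x : B // q} where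
  toFun
    | .inl x => .inl ⟨x.1, x.2.2⟩
    | .inr (.inl x) => .inr ⟨x.1, x.2.2⟩
    | .inr (.inr x) => (h x.2).elim
  invFun
    | .inl x => .inl ⟨x.1, h, x.2⟩
    | .inr x => .inr (.inl ⟨x.1, h, x.2⟩)
  left_inv := by
    rintro (x | x | x)
    · rfl
    · rfl
    · exact (h x.2).elim
  right_inv := by rintro (x | x) <;> rfl

def congr {A' : Type*} {B' : Type*} (e : A ≃ A') (f : B ≃ B') :
    Sync L a A B p q ≃ Sync L a A' B' p q :=
  Equiv.sumCongr (e.subtypeEquiv fun _ => Iff.rfl)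
    (Equiv.sumCongr (f.subtypeEquiv fun _ => Iff.rfl)
      ((Equiv.prodCongr e f).subtypeEquiv fun _ => Iff.rfl))

theorem nonempty_iff : Nonempty (Sync L a A B p q) ↔
    (Nonempty A ∧ a ∉ L ∧ p) ∨ (Nonempty B ∧ a ∉ L ∧ q) ∨ (Nonempty A ∧ Nonempty B ∧ a ∈ L) := by
  simp only [Sync, nonempty_sum, nonempty_subtype, exists_const_iff, nonempty_prod, and_assoc]

end Sync

namespace TDSHA

variable {X Ed Es W : Type u}

/-- The stochastic transitions of `T` from `q` to `q'` with event `a`. -/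
def StochFib (T : TDSHA X Ed Es W) (q : T.Mode) (a : Es) (q' : T.Mode) : Type u :=
  {i : T.stoch.Idx //
    (T.stoch.elem i).src = q ∧ (T.stoch.elem i).tgt = q' ∧ (T.stoch.elem i).event = a}

/-- The discrete transitions of `T` are given by the family `Tr`: all labels are determined by the
event, there is an instantaneous transition from `q` to `q'` with event `a` if and only if
`Tr q a q'` is inhabited, and there are as many stochastic ones as `Tr q a q'` has elements. -/
structure Presented (T : TDSHA X Ed Es W) (G : Ed ⊕ Es → Set (X → ℝ)) (Rs : Ed ⊕ Es → Reset X W)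
    (rt : Es → (X → ℝ) → NNReal) (Tr : T.Mode → Ed ⊕ Es → T.Mode → Type v) : Prop where
  inst : ∀ δ, δ ∈ T.inst ↔ Nonempty (Tr δ.src (Sum.inl δ.event) δ.tgt) ∧
    δ.guard = G (Sum.inl δ.event) ∧ δ.reset = Rs (Sum.inl δ.event) ∧ δ.weight = 1
  label : ∀ i, (T.stoch.elem i).guard = G (Sum.inr (T.stoch.elem i).event) ∧
    (T.stoch.elem i).reset = Rs (Sum.inr (T.stoch.elem i).event) ∧
    (T.stoch.elem i).rate = rt (T.stoch.elem i).event
  fib : ∀ q a q', Nonempty (T.StochFib q a q' ≃ Tr q (Sum.inr a) q')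

namespace Presented

variable {T T₁ T₂ : TDSHA X Ed Es W} {G G₁ G₂ : Ed ⊕ Es → Set (X → ℝ)}
  {Rs Rs₁ Rs₂ : Ed ⊕ Es → Reset X W} {rt : Es → (X → ℝ) → NNReal}

theorem congr {Tr : T.Mode → Ed ⊕ Es → T.Mode → Type v} {Tr' : T.Mode → Ed ⊕ Es → T.Mode → Type w}
    (h : T.Presented G Rs rt Tr) (e : ∀ q a q', Nonempty (Tr q a q' ≃ Tr' q a q')) :
    T.Presented G Rs rt Tr' where
  inst δ := by rw [h.inst, (e _ _ _).some.nonempty_congr]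
  label := h.label
  fib q a q' := ⟨(h.fib q a q').some.trans (e _ _ _).some⟩

/-- The product of two presented TDSHA. -/
theorem tprod {L : Set (Ed ⊕ Es)} {Tr₁ : T₁.Mode → Ed ⊕ Es → T₁.Mode → Type v}
    {Tr₂ : T₂.Mode → Ed ⊕ Es → T₂.Mode → Type w}
    (h₁ : T₁.Presented G₁ Rs₁ rt Tr₁) (h₂ : T₂.Presented G₂ Rs₂ rt Tr₂)
    (hl : ∀ a ∉ L, ∀ q q', Nonempty (Tr₁ q a q') → G₁ a = G a ∧ Rs₁ a = Rs a)
    (hr : ∀ a ∉ L, ∀ q q', Nonempty (Tr₂ q a q') → G₂ a = G a ∧ Rs₂ a = Rs a)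
    (hs : ∀ a ∈ L, G₁ a ∩ G₂ a = G a ∧ (Rs₁ a).conj (Rs₂ a) = Rs a) :
    (TDSHA.tprod L T₁ T₂).Presented G Rs rt fun q a q' =>
      Sync L a (Tr₁ q.1 a q'.1) (Tr₂ q.2 a q'.2) (q.2 = q'.2) (q.1 = q'.1) where
  inst := by
    rintro ⟨⟨q₁, q₂⟩, ⟨q₁', q₂'⟩, g, r, w, a⟩
    rw [Sync.nonempty_iff]
    constructor
    · rintro ((⟨δ, hδ, q, ha, h⟩ | ⟨δ, hδ, q, ha, h⟩) | ⟨δ, hδ, δ', hδ', he, ha, h⟩)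
      · obtain ⟨hn, hg, hR, hw⟩ := (h₁.inst δ).1 hδ
        obtain ⟨e1, e2⟩ := hl _ ha _ _ hn
        injection h with hs ht hg' hR' hw' ha'
        obtain ⟨rfl, rfl⟩ := Prod.mk.inj hs
        obtain ⟨rfl, rfl⟩ := Prod.mk.inj ht
        subst hg' hR' hw' ha'
        exact ⟨.inl ⟨hn, ha, rfl⟩, hg.trans e1, hR.trans e2, hw⟩
      · obtain ⟨hn, hg, hR, hw⟩ := (h₂.inst δ).1 hδ
        obtain ⟨e1, e2⟩ := hr _ ha _ _ hn
        injection h with hs ht hg' hR' hw' ha'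
        obtain ⟨rfl, rfl⟩ := Prod.mk.inj hs
        obtain ⟨rfl, rfl⟩ := Prod.mk.inj ht
        subst hg' hR' hw' ha'
        exact ⟨.inr (.inl ⟨hn, ha, rfl⟩), hg.trans e1, hR.trans e2, hw⟩
      · obtain ⟨hn, hg, hR, hw⟩ := (h₁.inst δ).1 hδ
        obtain ⟨hn', hg', hR', hw'⟩ := (h₂.inst δ').1 hδ'
        obtain ⟨e1, e2⟩ := hs _ ha
        rw [← he] at hn' hg' hR'
        injection h with hs ht hg'' hR'' hw'' ha'
        obtain ⟨rfl, rfl⟩ := Prod.mk.inj hs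
        obtain ⟨rfl, rfl⟩ := Prod.mk.inj ht
        subst hg'' hR'' hw'' ha'
        exact ⟨.inr (.inr ⟨hn, hn', ha⟩), by simp only [hg, hg', e1], by simp only [hR, hR', e2],
          by simp [hw, hw']⟩
    · rintro ⟨⟨hn, ha, h⟩ | ⟨hn, ha, h⟩ | ⟨hn, hn', ha⟩, hg, hR, hw⟩ <;> dsimp only at *
      · subst h hg hR hw
        obtain ⟨e1, e2⟩ := hl _ ha _ _ hn
        exact .inl (.inl ⟨⟨q₁, q₁', G (.inl a), Rs (.inl a), 1, a⟩,
          (h₁.inst _).2 ⟨hn, e1.symm, e2.symm, rfl⟩, q₂, ha, rfl⟩)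
      · subst h hg hR hw
        obtain ⟨e1, e2⟩ := hr _ ha _ _ hn
        exact .inl (.inr ⟨⟨q₂, q₂', G (.inl a), Rs (.inl a), 1, a⟩,
          (h₂.inst _).2 ⟨hn, e1.symm, e2.symm, rfl⟩, q₁, ha, rfl⟩)
      · subst hg hR hw
        obtain ⟨e1, e2⟩ := hs _ ha
        exact .inr ⟨⟨q₁, q₁', G₁ (.inl a), Rs₁ (.inl a), 1, a⟩,
          (h₁.inst _).2 ⟨hn, rfl, rfl, rfl⟩, ⟨q₂, q₂', G₂ (.inl a), Rs₂ (.inl a), 1, a⟩,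
          (h₂.inst _).2 ⟨hn', rfl, rfl, rfl⟩, rfl, ha, by simp only [e1, e2, min_self]; rfl⟩
  label := by
    rintro (⟨⟨i, ha⟩, q⟩ | ⟨q, i, ha⟩ | ⟨⟨i, j⟩, he, hr', ha⟩)
    · obtain ⟨hg, hR, hw⟩ := h₁.label i
      obtain ⟨e1, e2⟩ := hl _ ha _ _ ⟨(h₁.fib _ _ _).some ⟨i, rfl, rfl, rfl⟩⟩
      exact ⟨hg.trans e1, hR.trans e2, hw⟩
    · obtain ⟨hg, hR, hw⟩ := h₂.label i
      obtain ⟨e1, e2⟩ := hr _ ha _ _ ⟨(h₂.fib _ _ _).some ⟨i, rfl, rfl, rfl⟩⟩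
      exact ⟨hg.trans e1, hR.trans e2, hw⟩
    · obtain ⟨hg, hR, hw⟩ := h₁.label i
      obtain ⟨hg', hR', -⟩ := h₂.label j
      obtain ⟨e1, e2⟩ := hs _ ha
      dsimp only at he ha
      rw [← he] at hg' hR'
      refine ⟨?_, ?_, hw⟩
      · simp only [TDSHA.tprod, Sum.elim_inr, hg, hg']
        exact e1
      · simp only [TDSHA.tprod, Sum.elim_inr, hR, hR']
        exact e2
  fib := by
    rintro ⟨q₁, q₂⟩ a ⟨q₁', q₂'⟩
    refine ⟨Equiv.trans ?_ (Sync.congr (h₁.fib q₁ a q₁').some (h₂.fib q₂ a q₂').some)⟩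
    refine Equiv.trans (β := _ ⊕ _ ⊕ _) (Equiv.subtypeSum.trans
      (Equiv.sumCongr (Equiv.refl _) Equiv.subtypeSum)) ?_
    refine Equiv.sumCongr ?_ (Equiv.sumCongr ?_ ?_)
    · refine ⟨fun i => ⟨⟨i.1.1.1, ?_⟩, ?_⟩, fun j => ⟨(⟨j.1.1, ?_⟩, q₂), ?_⟩, ?_, ?_⟩
      · obtain ⟨⟨⟨i, ha⟩, q⟩, h1, h2, h3⟩ := i
        exact ⟨congrArg Prod.fst h1, congrArg Prod.fst h2, h3⟩
      · obtain ⟨⟨⟨i, ha⟩, q⟩, h1, h2, h3⟩ := i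
        have e : q = q₂ := congrArg Prod.snd h1
        have e' : q = q₂' := congrArg Prod.snd h2
        exact ⟨fun h => ha (h3 ▸ h), e.symm.trans e'⟩
      · obtain ⟨⟨i, h1, h2, h3⟩, h4, h5⟩ := j
        exact fun h => h4 (h3 ▸ h)
      · obtain ⟨⟨i, h1, h2, h3⟩, h4, h5⟩ := j
        exact ⟨Prod.ext h1 rfl, Prod.ext h2 h5, h3⟩
      · rintro ⟨⟨⟨i, ha⟩, q⟩, h1, h2, h3⟩
        obtain rfl : q = q₂ := congrArg Prod.snd h1
        rfl
      · rintro ⟨⟨i, h1, h2, h3⟩, h4, h5⟩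
        rfl
    · refine ⟨fun i => ⟨⟨i.1.2.1, ?_⟩, ?_⟩, fun j => ⟨(q₁, ⟨j.1.1, ?_⟩), ?_⟩, ?_, ?_⟩
      · obtain ⟨⟨q, ⟨i, ha⟩⟩, h1, h2, h3⟩ := i
        exact ⟨congrArg Prod.snd h1, congrArg Prod.snd h2, h3⟩
      · obtain ⟨⟨q, ⟨i, ha⟩⟩, h1, h2, h3⟩ := i
        have e : q = q₁ := congrArg Prod.fst h1
        have e' : q = q₁' := congrArg Prod.fst h2
        exact ⟨fun h => ha (h3 ▸ h), e.symm.trans e'⟩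
      · obtain ⟨⟨i, h1, h2, h3⟩, h4, h5⟩ := j
        exact fun h => h4 (h3 ▸ h)
      · obtain ⟨⟨i, h1, h2, h3⟩, h4, h5⟩ := j
        exact ⟨Prod.ext rfl h1, Prod.ext h5 h2, h3⟩
      · rintro ⟨⟨q, ⟨i, ha⟩⟩, h1, h2, h3⟩
        obtain rfl : q = q₁ := congrArg Prod.fst h1
        rfl
      · rintro ⟨⟨i, h1, h2, h3⟩, h4, h5⟩
        rfl
    · refine ⟨fun i => ⟨(⟨i.1.1.1, ?_⟩, ⟨i.1.1.2, ?_⟩), ?_⟩,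
        fun j => ⟨⟨(j.1.1.1, j.1.2.1), ?_⟩, ?_⟩, ?_, ?_⟩
      · obtain ⟨⟨⟨i, j⟩, he, hr', ha⟩, h1, h2, h3⟩ := i
        exact ⟨congrArg Prod.fst h1, congrArg Prod.fst h2, h3⟩
      · obtain ⟨⟨⟨i, j⟩, he, hr', ha⟩, h1, h2, h3⟩ := i
        exact ⟨congrArg Prod.snd h1, congrArg Prod.snd h2, he.symm.trans h3⟩
      · obtain ⟨⟨⟨i, j⟩, he, hr', ha⟩, h1, h2, h3⟩ := i
        exact h3 ▸ ha
      · obtain ⟨⟨⟨i, h1, h2, h3⟩, ⟨j, h1', h2', h3'⟩⟩, ha⟩ := j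
        have he := h3.trans h3'.symm
        -- both rates are determined by the common event
        exact ⟨he, by rw [(h₁.label i).2.2, (h₂.label j).2.2, he], by rw [h3]; exact ha⟩
      · obtain ⟨⟨⟨i, h1, h2, h3⟩, ⟨j, h1', h2', h3'⟩⟩, ha⟩ := j
        exact ⟨Prod.ext h1 h1', Prod.ext h2 h2', h3⟩
      · rintro ⟨⟨⟨i, j⟩, he, hr', ha⟩, h1, h2, h3⟩
        rfl
      · rintro ⟨⟨⟨i, h1, h2, h3⟩, ⟨j, h1', h2', h3'⟩⟩, ha⟩
        rfl

end Presented

end TDSHA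

/-! ### Isomorphism of pruned TDSHA -/

namespace TDSHA

variable {X Ed Es W : Type u}

/-- The flows of `T` are indexed by its modes and the elements of `N`: in each mode, each `x : N`
contributes exactly one flow, with vector `vec x` and a function that depends on the mode. -/
def FlowsBy (T : TDSHA X Ed Es W) (N : Type u) (vec : N → X → ℝ)
    (fn : T.Mode → N → (X → ℝ) → ℝ) : Prop :=
  ∃ nm : T.flows.Idx → N,
    (∀ i, (T.flows.elem i).vec = vec (nm i) ∧
      (T.flows.elem i).fn = fn (T.flows.elem i).mode (nm i)) ∧
    ∀ q x, ∃! i, (T.flows.elem i).mode = q ∧ nm i = x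

namespace Presented

variable {T T' : TDSHA X Ed Es W} {G : Ed ⊕ Es → Set (X → ℝ)}
  {Rs : Ed ⊕ Es → Reset X W} {rt : Es → (X → ℝ) → NNReal}
  {Tr : T.Mode → Ed ⊕ Es → T.Mode → Type v} {Tr' : T'.Mode → Ed ⊕ Es → T'.Mode → Type w}

theorem reachable_step (h : T.Presented G Rs rt Tr) {q q' : T.Mode} {a : Ed ⊕ Es}
    (hq : T.Reachable q) (ht : Nonempty (Tr q a q')) : T.Reachable q' := by
  rcases a with a | a
  · exact Reachable.inst ⟨q, q', G (.inl a), Rs (.inl a), 1, a⟩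
      ((h.inst _).2 ⟨ht, rfl, rfl, rfl⟩) hq
  · obtain ⟨i, h1, rfl, h3⟩ := (h.fib q a q').some.symm ht.some
    exact Reachable.stoch i (h1 ▸ hq)

theorem reachable_induction (h : T.Presented G Rs rt Tr) {P : T.Mode → Prop} (h₀ : P T.initMode)
    (hs : ∀ q a q', P q → Nonempty (Tr q a q') → P q') {q : T.Mode} (hq : T.Reachable q) : P q := by
  induction hq with
  | init => exact h₀
  | inst δ hδ _ ih => exact hs _ _ _ ih ((h.inst δ).1 hδ).1
  | stoch i _ ih => exact hs _ _ _ ih ⟨(h.fib _ _ _).some ⟨i, rfl, rfl, rfl⟩⟩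

/-- A simulation relates every reachable mode to a reachable mode. -/
theorem exists_reachable (h : T.Presented G Rs rt Tr) (h' : T'.Presented G Rs rt Tr')
    (B : T.Mode → T'.Mode → Prop) (init : B T.initMode T'.initMode)
    (forth : ∀ q p a q', B q p → Nonempty (Tr q a q') → ∃ p', B q' p')
    (tr : ∀ q p q' p' a, B q p → B q' p' → (Nonempty (Tr q a q') → Nonempty (Tr' p a p')))
    {q : T.Mode} (hq : T.Reachable q) : ∃ p, T'.Reachable p ∧ B q p := by
  refine h.reachable_induction (P := fun q => ∃ p, T'.Reachable p ∧ B q p)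
    ⟨_, .init, init⟩ ?_ hq
  rintro q a q' ⟨p, hp, hB⟩ ht
  obtain ⟨p', hB'⟩ := forth _ _ _ _ hB ht
  exact ⟨p', h'.reachable_step hp (tr _ _ _ _ _ hB hB' ht), hB'⟩

theorem mem_prune_inst (h : T.Presented G Rs rt Tr) (δ : InstTrans T.prune.Mode X Ed W) :
    δ ∈ T.prune.inst ↔ Nonempty (Tr δ.src.1 (Sum.inl δ.event) δ.tgt.1) ∧
      δ.guard = G (Sum.inl δ.event) ∧ δ.reset = Rs (Sum.inl δ.event) ∧ δ.weight = 1 :=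
  h.inst (δ.map Subtype.val)

/-- The indices of a given stochastic transition of the pruned TDSHA. -/
theorem prune_stoch_fiber (h : T.Presented G Rs rt Tr) (x : StochTrans T.prune.Mode X Es W) :
    Nonempty ({i // T.prune.stoch.elem i = x} ≃
      {_t : Tr x.src.1 (Sum.inr x.event) x.tgt.1 // x.guard = G (Sum.inr x.event) ∧
        x.reset = Rs (Sum.inr x.event) ∧ x.rate = rt x.event}) := by
  obtain ⟨q, q', g, r, f, a⟩ := x
  refine ⟨Equiv.trans ?_ ((h.fib q.1 a q'.1).some.subtypeEquiv
    (p := fun _ => g = G (.inr a) ∧ r = Rs (.inr a) ∧ f = rt a) fun _ => Iff.rfl)⟩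
  refine ⟨fun i => ⟨⟨i.1.1, ?_⟩, ?_⟩, fun j => ⟨⟨j.1.1, ?_⟩, ?_⟩, fun _ => rfl, fun _ => rfl⟩
  · obtain ⟨i, hi⟩ := i
    injection hi with h1 h2 h3 h4 h5 h6
    exact ⟨congrArg Subtype.val h1, congrArg Subtype.val h2, h6⟩
  · obtain ⟨i, hi⟩ := i
    injection hi with h1 h2 h3 h4 h5 h6
    subst h3 h4 h5 h6
    exact h.label i.1
  · obtain ⟨⟨i, h1, h2, h3⟩, -⟩ := j
    exact ⟨by rw [h1]; exact q.2, by rw [h2]; exact q'.2⟩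
  · obtain ⟨⟨i, h1, h2, rfl⟩, rfl, rfl, rfl⟩ := j
    exact (StochTrans.mk.injEq ..).mpr
      ⟨Subtype.ext h1, Subtype.ext h2, (h.label i).1, (h.label i).2.1, (h.label i).2.2, rfl⟩

/-- A relation between the modes of two presented TDSHA that is one-to-one, relates the initial
modes, and is a bisimulation that preserves the number of transitions and the flows, restricts to
an isomorphism between the reachable parts. -/
theorem exists_prune_iso {N : Type u} {vec : N → X → ℝ} {fn : T.Mode → N → (X → ℝ) → ℝ}
    {fn' : T'.Mode → N → (X → ℝ) → ℝ}
    (h : T.Presented G Rs rt Tr) (h' : T'.Presented G Rs rt Tr')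
    (hf : T.FlowsBy N vec fn) (hf' : T'.FlowsBy N vec fn')
    (B : T.Mode → T'.Mode → Prop)
    (right_unique : ∀ q p p', B q p → B q p' → p = p')
    (left_unique : ∀ q q' p, B q p → B q' p → q = q')
    (init : B T.initMode T'.initMode) (initReset : T.initReset = T'.initReset)
    (forth : ∀ q p a q', B q p → Nonempty (Tr q a q') → ∃ p', B q' p')
    (back : ∀ q p a p', B q p → Nonempty (Tr' p a p') → ∃ q', B q' p')
    (tr : ∀ q p q' p' a, B q p → B q' p' → Nonempty (Tr q a q' ≃ Tr' p a p'))
    (hfn : ∀ q p x, B q p → fn q x = fn' p x) :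
    ∃ ρ : T.prune.Iso T'.prune, ∀ q : T.prune.Mode, B q.1 (ρ.modes q).1 := by
  have H (q : T.prune.Mode) : ∃ p : T'.prune.Mode, B q.1 p.1 := by
    obtain ⟨p, hp, hB⟩ := h.exists_reachable h' B init forth
      (fun q p q' p' a hB hB' => (tr q p q' p' a hB hB').some.nonempty_congr.1) q.2
    exact ⟨⟨p, hp⟩, hB⟩
  have H' (p : T'.prune.Mode) : ∃ q : T.prune.Mode, B q.1 p.1 := by
    obtain ⟨q, hq, hB⟩ := h'.exists_reachable h (fun p q => B q p) init
      (fun p q a p' hB => back q p a p' hB)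
      (fun p q p' q' a hB hB' => (tr q p q' p' a hB hB').some.nonempty_congr.2) p.2
    exact ⟨⟨q, hq⟩, hB⟩
  choose f hF using H
  choose g hg using H'
  let ρ : T.prune.Mode ≃ T'.prune.Mode :=
    { toFun := f
      invFun := g
      left_inv := fun q => Subtype.ext (left_unique _ _ _ (hg _) (hF q))
      right_inv := fun p => Subtype.ext (right_unique _ _ _ (hF _) (hg p)) }
  have hρ (q : T.prune.Mode) : B q.1 (ρ q).1 := hF q
  refine ⟨⟨ρ, ?_, initReset, ?_, ?_, ?_⟩, hρ⟩
  · exact Subtype.ext (right_unique _ _ _ (hρ _) init)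
  · obtain ⟨nm, hl, hu⟩ := hf
    obtain ⟨nm', hl', hu'⟩ := hf'
    -- a flow of `T` corresponds to the flow of `T'` with the same name in the related mode
    choose φ hφ using fun i : T.prune.flows.Idx =>
      (hu' (ρ (T.prune.flows.elem i).mode).1 (nm i.1)).exists
    let φ' : T.prune.flows.Idx → T'.prune.flows.Idx := fun i =>
      ⟨φ i, (hφ i).1.symm ▸ (ρ (T.prune.flows.elem i).mode).2⟩
    have hmode (i) : (T'.prune.flows.elem (φ' i)).mode = ρ (T.prune.flows.elem i).mode :=
      Subtype.ext (hφ i).1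
    refine ⟨Equiv.ofBijective φ' ⟨fun i j hij => ?_, fun j => ?_⟩, fun i => ?_⟩
    · have e : (T.prune.flows.elem i).mode = (T.prune.flows.elem j).mode :=
        ρ.injective ((hmode i).symm.trans
          ((congrArg (fun k => (T'.prune.flows.elem k).mode) hij).trans (hmode j)))
      have e' : nm i.1 = nm j.1 := by
        rw [← (hφ i).2, ← (hφ j).2]; exact congrArg nm' (congrArg Subtype.val hij)
      exact Subtype.ext ((hu _ _).unique ⟨rfl, rfl⟩ ⟨(congrArg Subtype.val e).symm, e'.symm⟩)
    · obtain ⟨i, hi, hi'⟩ := (hu (ρ.symm (T'.prune.flows.elem j).mode).1 (nm' j.1)).exists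
      let i' : T.prune.flows.Idx := ⟨i, hi.symm ▸ (ρ.symm (T'.prune.flows.elem j).mode).2⟩
      have e : (T.prune.flows.elem i').mode = ρ.symm (T'.prune.flows.elem j).mode :=
        Subtype.ext hi
      refine ⟨i', Subtype.ext ((hu' _ _).unique (hφ i') ⟨?_, hi'.symm⟩)⟩
      rw [e, ρ.apply_symm_apply]
      rfl
    · have hm : (T'.flows.elem (φ i)).mode = (ρ (T.prune.flows.elem i).mode).1 := (hφ i).1
      have e1 : (T'.flows.elem (φ i)).vec = (T.flows.elem i.1).vec := by
        rw [(hl' _).1, (hl _).1, (hφ i).2]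
      have e2 : (T'.flows.elem (φ i)).fn = (T.flows.elem i.1).fn := by
        rw [(hl' _).2, (hl _).2, (hφ i).2, hm]
        exact (hfn _ _ _ (hρ _)).symm
      have e0 := hmode i
      change (⟨(T'.prune.flows.elem (φ' i)).mode, (T'.flows.elem (φ i)).vec,
        (T'.flows.elem (φ i)).fn⟩ : FlowTrans _ _) = ⟨_, _, _⟩
      rw [e0, e1, e2]
      rfl
  · have key (δ : InstTrans T.prune.Mode X Ed W) :
        δ.map ρ ∈ T'.prune.inst ↔ δ ∈ T.prune.inst := by
      rw [h.mem_prune_inst, h'.mem_prune_inst]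
      exact and_congr_left fun _ => (tr _ _ _ _ _ (hρ _) (hρ _)).some.nonempty_congr.symm
    ext δ'
    constructor
    · rintro ⟨δ, hδ, rfl⟩
      exact (key δ).2 hδ
    · intro hδ'
      have e : (δ'.map ρ.symm).map ρ = δ' := by simp [InstTrans.map]
      exact ⟨δ'.map ρ.symm, (key _).1 (e.symm ▸ hδ'), e⟩
  · let g : StochTrans T.prune.Mode X Es W ≃ StochTrans T'.prune.Mode X Es W :=
      ⟨StochTrans.map ρ, StochTrans.map ρ.symm, fun x => by simp [StochTrans.map],
        fun x => by simp [StochTrans.map]⟩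
    refine MSet.same_of_fibers g fun x => ⟨(h.prune_stoch_fiber x).some.trans
      (Equiv.trans ?_ (h'.prune_stoch_fiber (g x)).some.symm)⟩
    exact (tr _ _ _ _ _ (hρ _) (hρ _)).some.subtypeEquiv fun _ => Iff.rfl

end Presented

end TDSHA

/-! ### Derivations of cooperations -/

namespace Step

variable {E IN IT C : Type u} {env : C → Term E (Activity IN IT) C} {L : Set E} {a : E}
  {P P' Q Q' : Term E (Activity IN IT) C} {σ σ' : State IN IT}

theorem isGamma_right_iff {σ τ υ : State IN IT} : IsGamma σ τ σ υ ↔ υ = τ := by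
  refine ⟨fun h => funext fun x => ?_, fun h x => .inl ⟨rfl, congrFun h x⟩⟩
  rcases h x with ⟨-, h⟩ | ⟨h, h'⟩
  · exact h
  · exact h'.trans h

/-- If the right component leaves the state unchanged, then `Γ` returns the state of the left
component, so a synchronised derivation is a pair of derivations. -/
theorem coop_equiv_of_mem (h : a ∈ L) (hQ : ∀ Q' τ, Nonempty (Step env Q σ a Q' τ) → τ = σ) :
    Nonempty (Step env (.coop L P Q) σ a (.coop L P' Q') σ' ≃
      Step env P σ a P' σ' × Step env Q σ a Q' σ) := by
  let f (x : Step env P σ a P' σ' × Step env Q σ a Q' σ) :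
      Step env (.coop L P Q) σ a (.coop L P' Q') σ' :=
    .coopSync h x.1 x.2 (isGamma_right_iff.2 rfl)
  refine ⟨(Equiv.ofBijective f ⟨?_, ?_⟩).symm⟩
  · rintro ⟨x, y⟩ ⟨x', y'⟩ hxy
    simp only [f, coopSync.injEq, heq_eq_eq, true_and] at hxy
    exact Prod.ext hxy.1 hxy.2
  · intro d
    cases d with
    | coopLeft h' d => exact (h' h).elim
    | coopRight h' d => exact (h' h).elim
    | coopSync h' d e g =>
      obtain rfl := hQ _ _ ⟨e⟩
      obtain rfl := isGamma_right_iff.1 g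
      exact ⟨(d, e), rfl⟩

theorem coop_equiv_of_notMem (h : a ∉ L) :
    Nonempty (Step env (.coop L P Q) σ a (.coop L P' Q') σ' ≃
      {_x : Step env P σ a P' σ' // Q = Q'} ⊕ {_x : Step env Q σ a Q' σ' // P = P'}) := by
  let f : {_x : Step env P σ a P' σ' // Q = Q'} ⊕ {_x : Step env Q σ a Q' σ' // P = P'} →
      Step env (.coop L P Q) σ a (.coop L P' Q') σ'
    | .inl ⟨x, hx⟩ => hx ▸ .coopLeft h x
    | .inr ⟨x, hx⟩ => hx ▸ .coopRight h x
  refine ⟨(Equiv.ofBijective f ⟨?_, ?_⟩).symm⟩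
  · rintro (⟨x, rfl⟩ | ⟨x, hx⟩) (⟨y, hy⟩ | ⟨y, hy⟩) hxy
    · simpa [f] using hxy
    · subst hy
      simp [f] at hxy
    · subst hx hy
      simp [f] at hxy
    · subst hx
      simpa [f] using hxy
  · intro d
    cases d with
    | coopLeft h' d => exact ⟨.inl ⟨d, rfl⟩, rfl⟩
    | coopRight h' d => exact ⟨.inr ⟨d, rfl⟩, rfl⟩
    | coopSync h' d e g => exact (h h').elim

/-- A cooperation has at most one derivation of each transition if the components have, if no
event outside `L` is possible for both, and if each component determines its next state. -/
theorem coop_subsingleton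
    (hP : ∀ P' τ, Subsingleton (Step env P σ a P' τ))
    (hQ : ∀ Q' τ, Subsingleton (Step env Q σ a Q' τ))
    (dP : ∀ P' τ P'' τ', Nonempty (Step env P σ a P' τ) → Nonempty (Step env P σ a P'' τ') → τ = τ')
    (dQ : ∀ P' τ P'' τ', Nonempty (Step env Q σ a P' τ) → Nonempty (Step env Q σ a P'' τ') → τ = τ')
    (hL : ∀ P' τ Q' τ', Nonempty (Step env P σ a P' τ) → Nonempty (Step env Q σ a Q' τ') → a ∈ L)
    (R : Term E (Activity IN IT) C) (υ : State IN IT) :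
    Subsingleton (Step env (.coop L P Q) σ a R υ) := by
  refine ⟨fun d d' => ?_⟩
  cases d with
  | coopLeft h d =>
    cases d' with
    | coopLeft h' d' => rw [(hP _ _).elim d d']
    | coopRight h' d' => exact (h (hL _ _ _ _ ⟨d⟩ ⟨d'⟩)).elim
    | coopSync h' d' e' g => exact (h h').elim
  | coopRight h d =>
    cases d' with
    | coopLeft h' d' => exact (h (hL _ _ _ _ ⟨d'⟩ ⟨d⟩)).elim
    | coopRight h' d' => rw [(hQ _ _).elim d d']
    | coopSync h' d' e' g => exact (h h').elim
  | coopSync h d e g =>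
    cases d' with
    | coopLeft h' d' => exact (h' h).elim
    | coopRight h' d' => exact (h' h).elim
    | coopSync h' d' e' g' =>
      obtain rfl := dP _ _ _ _ ⟨d⟩ ⟨d'⟩
      obtain rfl := dQ _ _ _ _ ⟨e⟩ ⟨e'⟩
      rw [(hP _ _).elim d d', (hQ _ _).elim e e']

theorem coop_nonempty_iff {R : Term E (Activity IN IT) C} :
    Nonempty (Step env (.coop L P Q) σ a R σ') ↔
      (∃ P', a ∉ L ∧ R = .coop L P' Q ∧ Nonempty (Step env P σ a P' σ')) ∨
      (∃ Q', a ∉ L ∧ R = .coop L P Q' ∧ Nonempty (Step env Q σ a Q' σ')) ∨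
      ∃ P' Q' τ τ', a ∈ L ∧ R = .coop L P' Q' ∧ Nonempty (Step env P σ a P' τ) ∧
        Nonempty (Step env Q σ a Q' τ') ∧ IsGamma σ τ τ' σ' := by
  constructor
  · rintro ⟨d⟩
    cases d with
    | coopLeft h d => exact .inl ⟨_, h, rfl, ⟨d⟩⟩
    | coopRight h d => exact .inr (.inl ⟨_, h, rfl, ⟨d⟩⟩)
    | coopSync h d e g => exact .inr (.inr ⟨_, _, _, _, h, rfl, ⟨d⟩, ⟨e⟩, g⟩)
  · rintro (⟨P', h, rfl, ⟨d⟩⟩ | ⟨Q', h, rfl, ⟨d⟩⟩ | ⟨P', Q', τ, τ', h, rfl, ⟨d⟩, ⟨e⟩, g⟩)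
    · exact ⟨.coopLeft h d⟩
    · exact ⟨.coopRight h d⟩
    · exact ⟨.coopSync h d e g⟩

end Step

/-! ### Subcomponents -/

namespace Subcomp

variable {E IN IT C : Type u} {env : C → Term E (Activity IN IT) C} {a : E}
  {σ σ' : State IN IT} {P' : Term E (Activity IN IT) C}

theorem name_of_mem_prefixes {S : Subcomp E IN IT} {init : E} {α : Activity IN IT}
    (h : (a, α) ∈ S.prefixes init) : α.name = S.infl := by
  simp only [prefixes, List.mem_append, List.mem_map, List.mem_singleton, Prod.mk.injEq] at h
  rcases h with ⟨b, -, -, rfl⟩ | ⟨-, rfl⟩ <;> rfl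

/-- The sum of a list of influence prefixes, ending with the prefix `z`, all leading to `P`. -/
def sumTerm (P : Term E (Activity IN IT) C) (z : E × Activity IN IT)
    (l : List (E × Activity IN IT)) : Term E (Activity IN IT) C :=
  l.foldr (fun b Q => .choice (.ipre b.1 b.2 P) Q) (.ipre z.1 z.2 P)

theorem toTerm_eq_sumTerm (init : E) (S : Subcomp E IN IT) (c : C) :
    S.toTerm init c = sumTerm (.const c) (init, S.act S.initial)
      (S.branches.map fun b => (b.1, S.act b.2)) := by
  simp [toTerm, sumTerm, List.foldr_map]

theorem step_sumTerm_iff {P : Term E (Activity IN IT) C} {z : E × Activity IN IT}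
    {l : List (E × Activity IN IT)} :
    Nonempty (Step env (sumTerm P z l) σ a P' σ') ↔
      P' = P ∧ ∃ α, (a, α) ∈ l ++ [z] ∧ σ' = σ.upd α := by
  have key (b : E × Activity IN IT) : Nonempty (Step env (.ipre b.1 b.2 P) σ a P' σ') ↔
      P' = P ∧ ∃ α, (a, α) = b ∧ σ' = σ.upd α := by
    constructor
    · rintro ⟨d⟩
      cases d with
      | ipre h => exact ⟨rfl, _, rfl, h⟩
    · rintro ⟨rfl, α, rfl, h⟩
      exact ⟨.ipre h⟩
  induction l with
  | nil => simpa [sumTerm] using key z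
  | cons b l ih =>
    have : Nonempty (Step env (sumTerm P z (b :: l)) σ a P' σ') ↔
        Nonempty (Step env (.ipre b.1 b.2 P) σ a P' σ') ∨
        Nonempty (Step env (sumTerm P z l) σ a P' σ') := by
      constructor
      · rintro ⟨d⟩
        cases d with
        | left d => exact .inl ⟨d⟩
        | right d => exact .inr ⟨d⟩
      · rintro (⟨⟨d⟩⟩ | ⟨⟨d⟩⟩)
        · exact ⟨.left d⟩
        · exact ⟨.right d⟩
    refine (this.trans (or_congr (key b) ih)).trans ?_
    rw [← and_or_left, ← exists_or]
    simp only [List.cons_append, List.mem_cons, or_and_right]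

theorem step_sumTerm_subsingleton {P : Term E (Activity IN IT) C} {z : E × Activity IN IT}
    {l : List (E × Activity IN IT)} (hl : ((l ++ [z]).map Prod.fst).Nodup) :
    Subsingleton (Step env (sumTerm P z l) σ a P' σ') := by
  have key (b : E × Activity IN IT) : Subsingleton (Step env (.ipre b.1 b.2 P) σ a P' σ') := by
    refine ⟨fun d d' => ?_⟩
    cases d with
    | ipre h => cases d' with | ipre h' => rfl
  induction l with
  | nil => exact key z
  | cons b l ih =>
    simp only [List.cons_append, List.map_cons, List.nodup_cons] at hl
    have disj (h₁ : Nonempty (Step env (.ipre b.1 b.2 P) σ a P' σ'))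
        (h₂ : Nonempty (Step env (sumTerm P z l) σ a P' σ')) : False := by
      obtain ⟨-, α, hα, -⟩ := step_sumTerm_iff.1 h₂
      obtain ⟨d⟩ := h₁
      cases d
      exact hl.1 (List.mem_map.2 ⟨_, hα, rfl⟩)
    have := ih hl.2
    refine ⟨fun d d' => ?_⟩
    cases d with
    | left d =>
      cases d' with
      | left d' => rw [(key b).elim d d']
      | right d' => exact (disj ⟨d⟩ ⟨d'⟩).elim
    | right d =>
      cases d' with
      | left d' => exact (disj ⟨d'⟩ ⟨d⟩).elim
      | right d' => rw [this.elim d d']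

end Subcomp

/-! ### Uncontrolled systems -/

namespace Model

variable {V IN IT Ed Es SN K : Type u}

/-- The influence names of an uncontrolled system. -/
def names (M : Model V IN IT Ed Es SN K) (U : USys SN) : List IN :=
  U.leaves.map fun s => (M.sub s).infl

/-- The conditions of well-definedness that concern a part `U` of the uncontrolled system: distinct
subcomponents have distinct influence names, and within a subcomponent the events are distinct. -/
structure ProperU (M : Model V IN IT Ed Es SN K) (U : USys SN) : Prop where
  nodup : (M.names U).Nodup
  events : ∀ s ∈ U.leaves, (((M.sub s).prefixes (Sum.inl M.init)).map Prod.fst).Nodup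

open Classical in
/-- The new value that the event `a` of `U` gives to the influence `x`, if it sets this influence.
It does not depend on the state before the event. -/
def newVal (M : Model V IN IT Ed Es SN K) : USys SN → Ed ⊕ Es → IN → Option (ℝ × IT)
  | .sub s, a, x =>
      if h : ∃ p : ℝ × IT, (a, ⟨x, p.1, p.2⟩) ∈ (M.sub s).prefixes (Sum.inl M.init)
      then some h.choose else none
  | .coop U U', a, x => (M.newVal U a x).or (M.newVal U' a x)

open Classical in
/-- The value of the influence `x` in a mode of the TDSHA of `U`, if `x` is an influence of `U`. -/
def modeVal (M : Model V IN IT Ed Es SN K) :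
    (U : USys SN) → (M.tdshaU U).Mode → IN → Option (ℝ × IT)
  | .sub _, q, x => if x = q.1.name then some (q.1.strength, q.1.kind) else none
  | .coop U U', q, x => (M.modeVal U q.1 x).or (M.modeVal U' q.2 x)

variable {M : Model V IN IT Ed Es SN K}

theorem names_coop (U U' : USys SN) : M.names (.coop U U') = M.names U ++ M.names U' :=
  List.map_append

namespace ProperU

variable {U U' : USys SN}

theorem left (h : M.ProperU (.coop U U')) : M.ProperU U where
  nodup := (List.nodup_append.1 (names_coop U U' ▸ h.nodup)).1
  events s hs := h.events s (List.mem_append_left _ hs)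

theorem right (h : M.ProperU (.coop U U')) : M.ProperU U' where
  nodup := (List.nodup_append.1 (names_coop U U' ▸ h.nodup)).2.1
  events s hs := h.events s (List.mem_append_right _ hs)

theorem disjoint (h : M.ProperU (.coop U U')) {x : IN} (hx : x ∈ M.names U)
    (hx' : x ∈ M.names U') : False :=
  (List.nodup_append.1 (names_coop U U' ▸ h.nodup)).2.2 x hx x hx' rfl

theorem prefix_unique {s : SN} (h : M.ProperU (.sub s)) {a : Ed ⊕ Es} {α β : Activity IN IT}
    (hα : (a, α) ∈ (M.sub s).prefixes (Sum.inl M.init))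
    (hβ : (a, β) ∈ (M.sub s).prefixes (Sum.inl M.init)) : α = β :=
  congrArg Prod.snd (List.inj_on_of_nodup_map (h.events s (List.mem_singleton.2 rfl)) hα hβ rfl)

end ProperU

theorem newVal_sub_eq_some {s : SN} (h : M.ProperU (.sub s)) {a : Ed ⊕ Es} {x : IN} {p : ℝ × IT} :
    M.newVal (.sub s) a x = some p ↔
      (a, ⟨x, p.1, p.2⟩) ∈ (M.sub s).prefixes (Sum.inl M.init) := by
  unfold newVal
  split_ifs with hp
  · rw [Option.some_inj]
    refine ⟨fun e => e ▸ hp.choose_spec, fun hp' => ?_⟩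
    have := h.prefix_unique hp.choose_spec hp'
    injection this with h1 h2 h3
    exact Prod.ext h2 h3
  · simpa using fun hp' => hp ⟨p, hp'⟩

theorem mem_names_of_newVal {U : USys SN} {a : Ed ⊕ Es} {x : IN} (h : M.newVal U a x ≠ none) :
    x ∈ M.names U := by
  induction U with
  | sub s =>
    unfold newVal at h
    split_ifs at h with hp
    · obtain ⟨p, hp⟩ := hp
      exact List.mem_singleton.2 (Subcomp.name_of_mem_prefixes hp)
    · exact (h rfl).elim
  | coop U U' ih ih' =>
    rw [names_coop, List.mem_append]
    by_cases h1 : M.newVal U a x = none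
    · refine .inr (ih' fun h2 => h ?_)
      simp [newVal, h1, h2]
    · exact .inl (ih h1)

theorem newVal_eq_none {U : USys SN} {a : Ed ⊕ Es} (h : a ∉ M.uev U) (x : IN) :
    M.newVal U a x = none := by
  induction U with
  | sub s =>
    unfold newVal
    rw [dif_neg]
    rintro ⟨p, hp⟩
    exact h ⟨_, hp⟩
  | coop U U' ih ih' =>
    simp only [uev, Set.mem_union, not_or] at h
    simp [newVal, ih h.1, ih' h.2]

theorem modeVal_ne_none_iff {U : USys SN} {q : (M.tdshaU U).Mode} {x : IN} :
    M.modeVal U q x ≠ none ↔ x ∈ M.names U := by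
  induction U with
  | sub s =>
    obtain ⟨α, a, hα⟩ := q
    simp [modeVal, names, USys.leaves, Subcomp.name_of_mem_prefixes hα]
  | coop U U' ih ih' =>
    rw [names_coop, List.mem_append, ← ih (q := q.1), ← ih' (q := q.2)]
    simp only [modeVal, ne_eq, Option.or_eq_none_iff]
    tauto

theorem newVal_eq_none_of_notMem {U : USys SN} {a : Ed ⊕ Es} {x : IN} (h : x ∉ M.names U) :
    M.newVal U a x = none :=
  of_not_not fun h' => h (mem_names_of_newVal h')

theorem modeVal_eq_none {U : USys SN} {q : (M.tdshaU U).Mode} {x : IN} (h : x ∉ M.names U) :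
    M.modeVal U q x = none :=
  of_not_not fun h' => h (modeVal_ne_none_iff.1 h')

theorem modeVal_injective {U : USys SN} (h : M.ProperU U) {q q' : (M.tdshaU U).Mode}
    (e : ∀ x, M.modeVal U q x = M.modeVal U q' x) : q = q' := by
  induction U with
  | sub s =>
    obtain ⟨⟨n, r, I⟩, a, hα⟩ := q
    obtain ⟨⟨n', r', I'⟩, a', hα'⟩ := q'
    obtain rfl : n = _ := Subcomp.name_of_mem_prefixes hα
    obtain rfl : n' = _ := Subcomp.name_of_mem_prefixes hα'
    have := e (M.sub s).infl
    simp only [modeVal, if_true, Option.some_inj, Prod.mk.injEq] at this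
    obtain ⟨rfl, rfl⟩ := this
    rfl
  | coop U U' ih ih' =>
    refine Prod.ext (ih h.left fun x => ?_) (ih' h.right fun x => ?_)
    · have ex := e x
      simp only [modeVal] at ex
      by_cases hx : x ∈ M.names U
      · have h2 (q) : M.modeVal U' q x = none := modeVal_eq_none (h.disjoint hx)
        simpa [h2] using ex
      · have h1 (q) : M.modeVal U q x = none := modeVal_eq_none hx
        rw [h1, h1]
    · have ex := e x
      simp only [modeVal] at ex
      by_cases hx : x ∈ M.names U'
      · have h2 (q) : M.modeVal U q x = none := modeVal_eq_none fun h' => h.disjoint h' hx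
        simpa [h2] using ex
      · have h1 (q) : M.modeVal U' q x = none := modeVal_eq_none hx
        rw [h1, h1]

theorem active_iff {U : USys SN} (h : M.ProperU U) {q : (M.tdshaU U).Mode} {x : IN} {r : ℝ}
    {I : IT} : M.Active U q ⟨x, r, I⟩ ↔ M.modeVal U q x = some (r, I) := by
  induction U with
  | sub s =>
    obtain ⟨⟨n, r', I'⟩, hα⟩ := q
    simp only [Active, modeVal, Activity.mk.injEq]
    by_cases hx : x = n
    · simp only [hx, true_and, if_true, Option.some_inj, Prod.mk.injEq]
      exact and_congr eq_comm eq_comm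
    · simp [hx]
  | coop U U' ih ih' =>
    simp only [Active, modeVal, ih h.left, ih' h.right, Option.or_eq_some_iff]
    exact or_congr_right ⟨fun h2 => ⟨modeVal_eq_none fun h1 => h.disjoint h1
      (modeVal_ne_none_iff.1 (h2 ▸ Option.some_ne_none _)), h2⟩, And.right⟩

theorem modeVal_sub_eq {s : SN} (h : M.ProperU (.sub s)) {a : Ed ⊕ Es}
    {q q' : (M.tdshaU (.sub s)).Mode} (hq' : (a, q'.1) ∈ (M.sub s).prefixes (Sum.inl M.init))
    (x : IN) :
    M.modeVal (.sub s) q' x = (M.newVal (.sub s) a x).or (M.modeVal (.sub s) q x) := by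
  obtain ⟨α, hα'⟩ := q'
  dsimp only at hq'
  by_cases hx : x = α.name
  · have : M.newVal (.sub s) a x = some (α.strength, α.kind) :=
      (newVal_sub_eq_some h).2 (hx ▸ hq')
    rw [this]
    simp [modeVal, hx]
  · have hx' : x ∉ M.names (.sub s) := fun h' => hx ((List.mem_singleton.1 h').trans
      (Subcomp.name_of_mem_prefixes hq').symm)
    have h1 : M.newVal (.sub s) a x = none := newVal_eq_none_of_notMem hx'
    have h2 (q) : M.modeVal (.sub s) q x = none := modeVal_eq_none hx'
    rw [h1, h2 q]
    exact h2 _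

/-- Every event leads from every mode to some mode. -/
theorem exists_modeVal_eq {U : USys SN} (h : M.ProperU U) (a : Ed ⊕ Es) (q : (M.tdshaU U).Mode) :
    ∃ q', ∀ x, M.modeVal U q' x = (M.newVal U a x).or (M.modeVal U q x) := by
  induction U with
  | sub s =>
    by_cases ha : ∃ α, (a, α) ∈ (M.sub s).prefixes (Sum.inl M.init)
    · obtain ⟨α, hα⟩ := ha
      exact ⟨⟨α, a, hα⟩, modeVal_sub_eq h hα⟩
    · exact ⟨q, fun x => by simp [newVal_eq_none (U := .sub s) ha]⟩
  | coop U U' ih ih' =>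
    obtain ⟨q₁, h₁⟩ := ih h.left q.1
    obtain ⟨q₂, h₂⟩ := ih' h.right q.2
    refine ⟨(q₁, q₂), fun x => ?_⟩
    simp only [modeVal, newVal, h₁, h₂]
    by_cases hx : x ∈ M.names U
    · have h3 : M.newVal U' a x = none := newVal_eq_none_of_notMem (h.disjoint hx)
      simp [h3, Option.or_assoc]
    · have h3 : M.newVal U a x = none := newVal_eq_none_of_notMem hx
      have h4 : M.modeVal U q.1 x = none := modeVal_eq_none hx
      simp [h3, h4]

theorem init_mem_uev (U : USys SN) : Sum.inl M.init ∈ M.uev U := by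
  induction U with
  | sub s => exact ⟨_, List.mem_append_right _ (List.mem_singleton.2 rfl)⟩
  | coop U U' ih _ => exact .inl ih

theorem modeVal_initMode {U : USys SN} (h : M.ProperU U) (x : IN) :
    M.modeVal U (M.tdshaU U).initMode x = M.newVal U (Sum.inl M.init) x := by
  induction U with
  | sub s =>
    have hα : (Sum.inl M.init, (M.sub s).act (M.sub s).initial) ∈
        (M.sub s).prefixes (Sum.inl M.init) :=
      List.mem_append_right _ (List.mem_singleton.2 rfl)
    by_cases hx : x = (M.sub s).infl
    · subst hx
      rw [(newVal_sub_eq_some h (p := (M.sub s).initial)).2 hα]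
      simp [modeVal, tdshaU, tdshaSub, Subcomp.act]
    · have hx' : x ∉ M.names (.sub s) := fun h' => hx (List.mem_singleton.1 h')
      rw [newVal_eq_none_of_notMem hx', modeVal_eq_none hx']
  | coop U U' ih ih' =>
    simp only [modeVal, newVal, ← ih h.left, ← ih' h.right]
    rfl

/-- The transitions of an uncontrolled system: an event overwrites the influences that it sets and
leaves the others as they are. -/
theorem step_uterm_iff {U : USys SN} (h : M.ProperU U) {σ σ' : State IN IT} {a : Ed ⊕ Es}
    {P' : Term (Ed ⊕ Es) (Activity IN IT) (SN ⊕ K)} :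
    Nonempty (Step M.env (M.uterm U) σ a P' σ') ↔
      P' = M.uterm U ∧ a ∈ M.uev U ∧ ∀ x, σ' x = (M.newVal U a x).getD (σ x) := by
  induction U generalizing P' σ' with
  | sub s =>
    have : Nonempty (Step M.env (M.uterm (.sub s)) σ a P' σ') ↔
        Nonempty (Step M.env ((M.sub s).toTerm (Sum.inl M.init) (Sum.inl s)) σ a P' σ') := by
      constructor
      · rintro ⟨d⟩
        cases d with | const d => exact ⟨d⟩
      · rintro ⟨d⟩
        exact ⟨.const d⟩
    rw [this, Subcomp.toTerm_eq_sumTerm, Subcomp.step_sumTerm_iff]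
    refine and_congr Iff.rfl ?_
    change (∃ α, (a, α) ∈ (M.sub s).prefixes (Sum.inl M.init) ∧ _) ↔ (∃ α, _) ∧ _
    have key {α} (hα : (a, α) ∈ (M.sub s).prefixes (Sum.inl M.init)) (x : IN) :
        (M.newVal (.sub s) a x).getD (σ x) = σ.upd α x := by
      by_cases hx : x = α.name
      · rw [(newVal_sub_eq_some h (p := (α.strength, α.kind))).2 (hx ▸ hα)]
        simp [State.upd, hx]
      · have h1 : M.newVal (.sub s) a x = none := newVal_eq_none_of_notMem fun h' =>
          hx ((List.mem_singleton.1 h').trans (Subcomp.name_of_mem_prefixes hα).symm)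
        simp [h1, State.upd, hx]
    constructor
    · rintro ⟨α, hα, rfl⟩
      exact ⟨⟨α, hα⟩, fun x => (key hα x).symm⟩
    · rintro ⟨⟨α, hα⟩, h'⟩
      exact ⟨α, hα, funext fun x => (h' x).trans (key hα x)⟩
  | coop U U' ih ih' =>
    -- no influence is set by both components
    have disj (x) : M.newVal U a x = none ∨ M.newVal U' a x = none := by
      by_contra hx
      rw [not_or] at hx
      exact h.disjoint (mem_names_of_newVal hx.1) (mem_names_of_newVal hx.2)
    have gamma : IsGamma σ (fun x => (M.newVal U a x).getD (σ x))
        (fun x => (M.newVal U' a x).getD (σ x)) σ' ↔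
        ∀ x, σ' x = (M.newVal (.coop U U') a x).getD (σ x) := by
      refine forall_congr' fun x => ?_
      rcases disj x with hx | hx
      · simp only [newVal, hx, Option.getD_none, Option.none_or, true_and]
        exact ⟨fun h => h.elim (fun h => h.2.trans h.1) id, .inr⟩
      · simp only [newVal, hx, Option.getD_none, Option.or_none, true_and]
        exact ⟨fun h => h.elim id (fun h => h.2.trans h.1), .inl⟩
    simp only [uterm, Step.coop_nonempty_iff, ih h.left, ih' h.right, uev, Set.mem_inter_iff,
      Set.mem_union]
    constructor
    · rintro (⟨P', hL, rfl, rfl, ha, hσ⟩ | ⟨P', hL, rfl, rfl, ha, hσ⟩ |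
        ⟨P', Q', τ, τ', hL, rfl, ⟨rfl, -, h1⟩, ⟨rfl, -, h2⟩, g⟩)
      · refine ⟨rfl, .inl ha, fun x => ?_⟩
        rw [hσ, newVal, newVal_eq_none fun ha' => hL ⟨ha, ha'⟩, Option.or_none]
      · refine ⟨rfl, .inr ha, fun x => ?_⟩
        rw [hσ, newVal, newVal_eq_none fun ha' => hL ⟨ha', ha⟩, Option.none_or]
      · obtain rfl := funext h1
        obtain rfl := funext h2
        exact ⟨rfl, .inl hL.1, gamma.1 g⟩
    · rintro ⟨rfl, ha, hσ⟩
      by_cases h1 : a ∈ M.uev U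
      · by_cases h2 : a ∈ M.uev U'
        · exact .inr (.inr ⟨_, _, _, _, ⟨h1, h2⟩, rfl, ⟨rfl, h1, fun _ => rfl⟩,
            ⟨rfl, h2, fun _ => rfl⟩, gamma.2 hσ⟩)
        · refine .inl ⟨_, fun h => h2 h.2, rfl, rfl, h1, fun x => ?_⟩
          rw [hσ, newVal, newVal_eq_none h2, Option.or_none]
      · refine .inr (.inl ⟨_, fun h => h1 h.1, rfl, rfl, ha.resolve_left h1, fun x => ?_⟩)
        rw [hσ, newVal, newVal_eq_none h1, Option.none_or]

theorem step_uterm_subsingleton {U : USys SN} (h : M.ProperU U) {σ σ' : State IN IT} {a : Ed ⊕ Es}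
    {P' : Term (Ed ⊕ Es) (Activity IN IT) (SN ⊕ K)} :
    Subsingleton (Step M.env (M.uterm U) σ a P' σ') := by
  induction U generalizing P' σ' with
  | sub s =>
    have : Subsingleton (Step M.env ((M.sub s).toTerm (Sum.inl M.init) (Sum.inl s)) σ a P' σ') := by
      rw [Subcomp.toTerm_eq_sumTerm]
      exact Subcomp.step_sumTerm_subsingleton (h.events s (List.mem_singleton.2 rfl))
    refine ⟨fun d d' => ?_⟩
    cases d with | const d =>
    cases d' with | const d' =>
    exact congrArg Step.const (this.elim d d')
  | coop U U' ih ih' =>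
    refine Step.coop_subsingleton (fun _ _ => ih h.left) (fun _ _ => ih' h.right)
      (fun _ _ _ _ h1 h2 => ?_) (fun _ _ _ _ h1 h2 => ?_) (fun _ _ _ _ h1 h2 => ?_) _ _
    · rw [step_uterm_iff h.left] at h1 h2
      exact funext fun x => (h1.2.2 x).trans (h2.2.2 x).symm
    · rw [step_uterm_iff h.right] at h1 h2
      exact funext fun x => (h1.2.2 x).trans (h2.2.2 x).symm
    · rw [step_uterm_iff h.left] at h1
      rw [step_uterm_iff h.right] at h2
      exact ⟨h1.2.1, h2.2.1⟩

end Model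

theorem nonempty_equiv_of_subsingleton {A : Type u} {B : Type v} [Subsingleton A] [Subsingleton B]
    (h : Nonempty A ↔ Nonempty B) : Nonempty (A ≃ B) :=
  ⟨equivOfSubsingletonOfSubsingleton (fun a => (h.1 ⟨a⟩).some) (fun b => (h.2 ⟨b⟩).some)⟩

namespace Model

variable {V IN IT Ed Es SN K : Type u} {M : Model V IN IT Ed Es SN K}

/-- The event `a` leads from the mode `q` to the mode `q'` of the TDSHA of `U`. -/
def ModeStep (M : Model V IN IT Ed Es SN K) (U : USys SN) (q : (M.tdshaU U).Mode) (a : Ed ⊕ Es)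
    (q' : (M.tdshaU U).Mode) : Prop :=
  a ∈ M.uev U ∧ ∀ x, M.modeVal U q' x = (M.newVal U a x).or (M.modeVal U q x)

theorem modeStep_sub_iff {s : SN} (h : M.ProperU (.sub s)) {q q' : (M.tdshaU (.sub s)).Mode}
    {a : Ed ⊕ Es} :
    M.ModeStep (.sub s) q a q' ↔ (a, q'.1) ∈ (M.sub s).prefixes (Sum.inl M.init) := by
  refine ⟨fun ⟨⟨α, hα⟩, hq'⟩ => ?_, fun hq' => ⟨⟨_, hq'⟩, modeVal_sub_eq h hq'⟩⟩
  obtain rfl : q' = ⟨α, a, hα⟩ := modeVal_injective h fun x =>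
    (hq' x).trans (modeVal_sub_eq (q' := ⟨α, a, hα⟩) h hα x).symm
  exact hα

theorem modeStep_coop_iff_of_mem {U U' : USys SN} (h : M.ProperU (.coop U U')) {a : Ed ⊕ Es}
    (ha : a ∈ M.uev U ∩ M.uev U') {q q' : (M.tdshaU (.coop U U')).Mode} :
    M.ModeStep (.coop U U') q a q' ↔ M.ModeStep U q.1 a q'.1 ∧ M.ModeStep U' q.2 a q'.2 := by
  simp only [ModeStep, modeVal, newVal, uev, Set.mem_union, ha.1, ha.2, true_or, true_and,
    ← forall_and]
  refine forall_congr' fun x => ?_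
  by_cases hx : x ∈ M.names U
  · have h1 : M.newVal U' a x = none := newVal_eq_none_of_notMem (h.disjoint hx)
    have h2 (q) : M.modeVal U' q x = none := modeVal_eq_none (h.disjoint hx)
    simp [h1, h2]
  · have h1 : M.newVal U a x = none := newVal_eq_none_of_notMem hx
    have h2 (q) : M.modeVal U q x = none := modeVal_eq_none hx
    simp [h1, h2]

theorem modeStep_coop_iff_left {U U' : USys SN} (h : M.ProperU (.coop U U')) {a : Ed ⊕ Es}
    (ha : a ∉ M.uev U') {q q' : (M.tdshaU (.coop U U')).Mode} :
    M.ModeStep (.coop U U') q a q' ↔ M.ModeStep U q.1 a q'.1 ∧ q.2 = q'.2 := by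
  have e : q.2 = q'.2 ↔ ∀ x, M.modeVal U' q'.2 x = M.modeVal U' q.2 x :=
    ⟨fun e x => by rw [e], fun e => (modeVal_injective h.right e).symm⟩
  simp only [ModeStep, modeVal, newVal, uev, Set.mem_union, ha, or_false, e, and_assoc,
    newVal_eq_none ha, Option.or_none, ← forall_and]
  refine and_congr_right fun _ => forall_congr' fun x => ?_
  by_cases hx : x ∈ M.names U
  · have h2 (q) : M.modeVal U' q x = none := modeVal_eq_none (h.disjoint hx)
    simp [h2]
  · have h1 : M.newVal U a x = none := newVal_eq_none_of_notMem hx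
    have h2 (q) : M.modeVal U q x = none := modeVal_eq_none hx
    simp [h1, h2]

theorem modeStep_coop_iff_right {U U' : USys SN} (h : M.ProperU (.coop U U')) {a : Ed ⊕ Es}
    (ha : a ∉ M.uev U) {q q' : (M.tdshaU (.coop U U')).Mode} :
    M.ModeStep (.coop U U') q a q' ↔ M.ModeStep U' q.2 a q'.2 ∧ q.1 = q'.1 := by
  have e : q.1 = q'.1 ↔ ∀ x, M.modeVal U q'.1 x = M.modeVal U q.1 x :=
    ⟨fun e x => by rw [e], fun e => (modeVal_injective h.left e).symm⟩
  simp only [ModeStep, modeVal, newVal, uev, Set.mem_union, ha, false_or, e, and_assoc,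
    newVal_eq_none ha, Option.none_or, ← forall_and]
  refine and_congr_right fun _ => forall_congr' fun x => ?_
  by_cases hx : x ∈ M.names U
  · have h1 : M.newVal U' a x = none := newVal_eq_none_of_notMem (h.disjoint hx)
    have h2 (q) : M.modeVal U' q x = none := modeVal_eq_none (h.disjoint hx)
    simp [h1, h2]
  · have h2 (q) : M.modeVal U q x = none := modeVal_eq_none hx
    simp [h2]

/-- The rules for the product of the TDSHA of `U` and `U'` yield each mode step exactly once: an
event outside the synchronisation set belongs to at most one of the factors. -/
theorem sync_equiv_modeStep {U U' : USys SN} (h : M.ProperU (.coop U U')) (a : Ed ⊕ Es)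
    (q q' : (M.tdshaU (.coop U U')).Mode) :
    Nonempty (Sync (M.uev U ∩ M.uev U') a (PLift (M.ModeStep U q.1 a q'.1))
      (PLift (M.ModeStep U' q.2 a q'.2)) (q.2 = q'.2) (q.1 = q'.1) ≃
        PLift (M.ModeStep (.coop U U') q a q')) := by
  by_cases ha : a ∈ M.uev U ∩ M.uev U'
  · have := (Sync.equivOfMem ha (A := PLift (M.ModeStep U q.1 a q'.1))
      (B := PLift (M.ModeStep U' q.2 a q'.2)) (p := q.2 = q'.2) (q := q.1 = q'.1)).subsingleton
    refine nonempty_equiv_of_subsingleton ?_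
    simp only [Sync.nonempty_iff, nonempty_plift, nonempty_prop, ha, not_true_eq_false,
      false_and, and_false,
      false_or, and_true, modeStep_coop_iff_of_mem h ha]
  · refine Nonempty.map (Sync.equivOfNotMem ha).trans ?_
    by_cases ha' : a ∈ M.uev U'
    · have h1 : a ∉ M.uev U := fun h1 => ha ⟨h1, ha'⟩
      have : IsEmpty (PLift (M.ModeStep U q.1 a q'.1)) := ⟨fun t => h1 t.1.1⟩
      refine ⟨(Equiv.emptySum _ _).trans (nonempty_equiv_of_subsingleton ?_).some⟩
      simp only [nonempty_subtype, nonempty_plift, nonempty_prop, modeStep_coop_iff_right h h1]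
      exact ⟨fun ⟨t, e⟩ => ⟨t.1, e⟩, fun ⟨t, e⟩ => ⟨⟨t⟩, e⟩⟩
    · have : IsEmpty (PLift (M.ModeStep U' q.2 a q'.2)) := ⟨fun t => ha' t.1.1⟩
      refine ⟨(Equiv.sumEmpty _ _).trans (nonempty_equiv_of_subsingleton ?_).some⟩
      simp only [nonempty_subtype, nonempty_plift, nonempty_prop, modeStep_coop_iff_left h ha']
      exact ⟨fun ⟨t, e⟩ => ⟨t.1, e⟩, fun ⟨t, e⟩ => ⟨⟨t⟩, e⟩⟩

/-- The transitions of the TDSHA of `U` carry no information besides source, target and event, and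
each is present exactly once if the event leads from the source to the target. -/
theorem presented_tdshaU {U : USys SN} (h : M.ProperU U) :
    (M.tdshaU U).Presented (fun _ => Set.univ) (fun _ => Reset.tt) M.rate
      fun q a q' => PLift (M.ModeStep U q a q') := by
  induction U with
  | sub s =>
    refine ⟨?_, fun i => ⟨rfl, rfl, rfl⟩, fun q a q' => ?_⟩
    · rintro ⟨q, q', g, r, w, a⟩
      rw [nonempty_plift, nonempty_prop, modeStep_sub_iff h]
      constructor
      · rintro ⟨α, β, b, hb, e⟩
        injection e with e1 e2 e3 e4 e5 e6
        subst e1 e2 e3 e4 e5 e6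
        exact ⟨hb, rfl, rfl, rfl⟩
      · rintro ⟨hb, hg, hr, hw⟩
        dsimp only at hg hr hw
        subst hg hr hw
        exact ⟨q, q', a, hb, rfl⟩
    · have : Subsingleton ((M.tdshaU (.sub s)).StochFib q a q') := by
        refine ⟨fun i j => Subtype.ext (Subtype.ext ?_)⟩
        exact Prod.ext (i.2.1.trans j.2.1.symm)
          (Prod.ext (i.2.2.1.trans j.2.2.1.symm) (i.2.2.2.trans j.2.2.2.symm))
      refine nonempty_equiv_of_subsingleton ?_
      rw [nonempty_plift, nonempty_prop, modeStep_sub_iff h]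
      constructor
      · rintro ⟨⟨⟨⟨_, _, _⟩, h1⟩, rfl, rfl, rfl⟩⟩
        exact h1
      · exact fun h1 => ⟨⟨⟨(q, q', a), h1⟩, rfl, rfl, rfl⟩⟩
  | coop U U' ih ih' =>
    refine ((ih h.left).tprod (ih' h.right) (fun _ _ _ _ _ => ⟨rfl, rfl⟩)
      (fun _ _ _ _ _ => ⟨rfl, rfl⟩) fun _ _ => ⟨Set.inter_self _, ?_⟩).congr
        fun q a q' => sync_equiv_modeStep h a q q'
    simp [Reset.conj, Reset.tt]

/-- In each mode of the TDSHA of `U`, each influence of `U` has exactly one flow, which is given by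
the value of the influence in this mode. -/
theorem flows_tdshaU {U : USys SN} (h : M.ProperU U) :
    ∃ nm : (M.tdshaU U).flows.Idx → IN,
      (∀ i, ∃ p, M.modeVal U ((M.tdshaU U).flows.elem i).mode (nm i) = some p ∧
        ((M.tdshaU U).flows.elem i).vec = unitVec (M.iv (nm i)) ∧
        ((M.tdshaU U).flows.elem i).fn = M.flowFn p.1 p.2) ∧
      ∀ q, ∀ x ∈ M.names U, ∃! i, ((M.tdshaU U).flows.elem i).mode = q ∧ nm i = x := by
  induction U with
  | sub s =>
    refine ⟨fun i => i.1.name, fun i => ⟨(i.1.strength, i.1.kind), ?_, rfl, rfl⟩,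
      fun q x hx => ⟨q, ⟨rfl, ?_⟩, fun i hi => hi.1⟩⟩
    · simp [modeVal, tdshaU, tdshaSub]
    · obtain ⟨α, a, hα⟩ := q
      exact (Subcomp.name_of_mem_prefixes hα).trans (List.mem_singleton.1 hx).symm
  | coop U U' ih ih' =>
    obtain ⟨nm, h1, h2⟩ := ih h.left
    obtain ⟨nm', h1', h2'⟩ := ih' h.right
    have hnm (i) : nm i ∈ M.names U := by
      obtain ⟨p, hp, -⟩ := h1 i
      exact modeVal_ne_none_iff.1 (hp ▸ Option.some_ne_none _)
    have hnm' (i) : nm' i ∈ M.names U' := by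
      obtain ⟨p, hp, -⟩ := h1' i
      exact modeVal_ne_none_iff.1 (hp ▸ Option.some_ne_none _)
    refine ⟨Sum.elim (fun i => nm i.1) (fun i => nm' i.2), ?_, ?_⟩
    · rintro (⟨i, q⟩ | ⟨q, i⟩)
      · obtain ⟨p, hp, e⟩ := h1 i
        refine ⟨p, ?_, e⟩
        exact congrArg (Option.or · _) hp
      · obtain ⟨p, hp, e⟩ := h1' i
        refine ⟨p, ?_, e⟩
        change (M.modeVal U _ (nm' i)).or _ = _
        have : M.modeVal U q (nm' i) = none := modeVal_eq_none fun hq => h.disjoint hq (hnm' i)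
        exact (congrArg (Option.or · _) this).trans (Option.none_or.trans hp)
    · rintro ⟨q₁, q₂⟩ x hx
      rw [names_coop, List.mem_append] at hx
      rcases hx with hx | hx
      · obtain ⟨i, ⟨hi, hi'⟩, hu⟩ := h2 q₁ x hx
        refine ⟨.inl (i, q₂), ⟨Prod.ext hi rfl, hi'⟩, ?_⟩
        rintro (⟨j, q⟩ | ⟨q, j⟩) ⟨hj, hj'⟩
        · obtain rfl := hu j ⟨congrArg Prod.fst hj, hj'⟩
          obtain rfl : q = q₂ := congrArg Prod.snd hj
          rfl
        · obtain rfl : nm' j = x := hj'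
          exact (h.disjoint hx (hnm' j)).elim
      · obtain ⟨i, ⟨hi, hi'⟩, hu⟩ := h2' q₂ x hx
        refine ⟨.inr (q₁, i), ⟨Prod.ext rfl hi, hi'⟩, ?_⟩
        rintro (⟨j, q⟩ | ⟨q, j⟩) ⟨hj, hj'⟩
        · obtain rfl : nm j = x := hj'
          exact (h.disjoint (hnm j) hx).elim
        · obtain rfl := hu j ⟨congrArg Prod.snd hj, hj'⟩
          obtain rfl : q = q₁ := congrArg Prod.fst hj
          rfl

theorem finite_mode_tdshaU (U : USys SN) : Finite (M.tdshaU U).Mode := by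
  induction U with
  | sub s =>
    refine Set.Finite.subset (List.finite_toSet
      (((M.sub s).prefixes (Sum.inl M.init)).map Prod.snd)) ?_
    rintro α ⟨a, h⟩
    exact List.mem_map.2 ⟨_, h, rfl⟩
  | coop U U' ih ih' => exact @Finite.instProd _ _ ih ih'

theorem initReset_tdshaU (U : USys SN) : (M.tdshaU U).initReset = Reset.tt := by
  induction U with
  | sub s => rfl
  | coop U U' ih ih' =>
    change ((M.tdshaU U).initReset).conj (M.tdshaU U').initReset = _
    simp [ih, ih', Reset.conj, Reset.tt]

end Model

/-! ### Controllers -/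

theorem Seq.toTerm_injective {E K A SN : Type u} : Function.Injective
    (Seq.toTerm A SN : Seq E K → Term E A (SN ⊕ K)) := by
  intro N N' h
  induction N generalizing N' with
  | nil => cases N' <;> simp_all [Seq.toTerm]
  | pre a N ih =>
    cases N' <;> simp only [Seq.toTerm, reduceCtorEq, Term.pre.injEq] at h
    rw [h.1, ih h.2]
  | sum N₁ N₂ ih₁ ih₂ =>
    cases N' <;> simp only [Seq.toTerm, reduceCtorEq, Term.choice.injEq] at h
    rw [ih₁ h.1, ih₂ h.2]
  | const k => cases N' <;> simp_all [Seq.toTerm]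

theorem Seq.Occurs.of_summand {E K : Type u} {body : K → Seq E K} {N N' : Seq E K} {a b : E}
    (s : Summand body N b N') : N.Occurs body b ∧ (N'.Occurs body a → N.Occurs body a) := by
  induction s with
  | pre b M => exact ⟨.head _, .tail _⟩
  | left s ih => exact ⟨.left _ ih.1, fun h => .left _ (ih.2 h)⟩
  | right s ih => exact ⟨.right _ ih.1, fun h => .right _ (ih.2 h)⟩
  | const s ih => exact ⟨.const ih.1, fun h => .const (ih.2 h)⟩

theorem SeqDs.occurs {E K : Type u} {body : K → Seq E K} {N N' : Seq E K} {a : E}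
    (h : SeqDs body N N') (ha : N'.Occurs body a) : N.Occurs body a := by
  induction h with
  | refl => exact ha
  | step _ s ih => exact ih ((Seq.Occurs.of_summand s.some).2 ha)

/-- The subterms of a sequential controller, constants not being replaced by their definitions. -/
def Seq.subterms {E K : Type u} : Seq E K → Set (Seq E K)
  | .nil => {.nil}
  | .pre a N => insert (.pre a N) N.subterms
  | .sum N N' => insert (.sum N N') (N.subterms ∪ N'.subterms)
  | .const k => {.const k}

theorem Seq.finite_subterms {E K : Type u} (N : Seq E K) : N.subterms.Finite := by
  induction N with
  | nil => exact Set.finite_singleton _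
  | pre a N ih => exact ih.insert _
  | sum N N' ih ih' => exact (ih.union ih').insert _
  | const k => exact Set.finite_singleton _

theorem Seq.self_mem_subterms {E K : Type u} (N : Seq E K) : N ∈ N.subterms := by
  cases N <;> simp [Seq.subterms]

theorem Seq.subterms_subset {E K : Type u} {N N' : Seq E K} (h : N' ∈ N.subterms) :
    N'.subterms ⊆ N.subterms := by
  induction N with
  | nil => obtain rfl := h; exact subset_rfl
  | pre a N ih =>
    rcases h with rfl | h
    · exact subset_rfl
    · exact (ih h).trans (Set.subset_insert _ _)
  | sum N₁ N₂ ih₁ ih₂ =>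
    rcases h with rfl | h | h
    · exact subset_rfl
    · exact ((ih₁ h).trans Set.subset_union_left).trans (Set.subset_insert _ _)
    · exact ((ih₂ h).trans Set.subset_union_right).trans (Set.subset_insert _ _)
  | const k => obtain rfl := h; exact subset_rfl

/-- Derivatives are subterms of the controller or of the definition of a constant. -/
theorem SeqDs.finite {E K : Type u} [Finite K] (body : K → Seq E K) (N : Seq E K) :
    Finite {N' // SeqDs body N N'} := by
  let S : Set (Seq E K) := N.subterms ∪ ⋃ k, (body k).subterms
  have hS {N₁ : Seq E K} (h : N₁ ∈ S) : N₁.subterms ⊆ S := by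
    rcases h with h | h
    · exact (Seq.subterms_subset h).trans Set.subset_union_left
    · obtain ⟨k, h⟩ := Set.mem_iUnion.1 h
      exact ((Seq.subterms_subset h).trans (Set.subset_iUnion (fun k => (body k).subterms) k)).trans
        Set.subset_union_right
  have key {N₁ N₂ : Seq E K} {a : E} (s : Summand body N₁ a N₂) : N₁ ∈ S → N₂ ∈ S := by
    induction s with
    | pre a M => exact fun h => hS h (.inr M.self_mem_subterms)
    | left s ih => exact fun h => ih (hS h (.inr (.inl (Seq.self_mem_subterms _))))
    | right s ih => exact fun h => ih (hS h (.inr (.inr (Seq.self_mem_subterms _))))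
    | const s ih => exact fun _ => ih (.inr (Set.mem_iUnion.2 ⟨_, Seq.self_mem_subterms _⟩))
  refine Set.Finite.subset (s := S) (N.finite_subterms.union
    (Set.finite_iUnion fun k => (body k).finite_subterms)) fun N' h => ?_
  induction h with
  | refl => exact .inl N.self_mem_subterms
  | step _ s ih => exact key s.some ih

namespace Model

variable {V IN IT Ed Es SN K : Type u} {M : Model V IN IT Ed Es SN K}

/-- The derivation by which an occurrence of a summand is executed. -/
def stepOfSummand (M : Model V IN IT Ed Es SN K) (σ : State IN IT) :
    {N N' : Seq (Ed ⊕ Es) K} → {a : Ed ⊕ Es} → Summand M.body N a N' →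
      Step M.env (N.toTerm (Activity IN IT) SN) σ a (N'.toTerm (Activity IN IT) SN) σ
  | _, _, _, .pre _ _ => .pre
  | _, _, _, .left s => .left (M.stepOfSummand σ s)
  | _, _, _, .right s => .right (M.stepOfSummand σ s)
  | _, _, _, .const s => .const (M.stepOfSummand σ s)

theorem stepOfSummand_injective (σ : State IN IT) {N N' : Seq (Ed ⊕ Es) K} {a : Ed ⊕ Es} :
    Function.Injective (M.stepOfSummand σ : Summand M.body N a N' → _) := by
  intro s s' h
  induction s with
  | pre a M => cases s'; rfl
  | left s ih =>
    cases s' with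
    | left s' => exact congrArg _ (ih (Step.left.inj h))
    | right s' => cases h
  | right s ih =>
    cases s' with
    | left s' => cases h
    | right s' => exact congrArg _ (ih (Step.right.inj h))
  | const s ih =>
    cases s' with
    | const s' => exact congrArg _ (ih (Step.const.inj h))

/-- Every derivation of a sequential controller executes a summand; in particular it leaves the
state unchanged. -/
theorem exists_stepOfSummand {σ σ' : State IN IT} {a : Ed ⊕ Es}
    {P P' : Term (Ed ⊕ Es) (Activity IN IT) (SN ⊕ K)} (d : Step M.env P σ a P' σ')
    {N : Seq (Ed ⊕ Es) K} (hP : P = N.toTerm (Activity IN IT) SN) :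
    σ' = σ ∧ ∃ N', P' = Seq.toTerm (Activity IN IT) SN N' ∧
      ∃ s : Summand M.body N a N', HEq d (M.stepOfSummand σ s) := by
  induction d generalizing N with
  | ipre h => cases N <;> cases hP
  | pre =>
    cases N <;> cases hP
    exact ⟨rfl, _, rfl, .pre _ _, HEq.rfl⟩
  | left d ih =>
    cases N <;> cases hP
    obtain ⟨rfl, N', rfl, s, hs⟩ := ih rfl
    obtain rfl := eq_of_heq hs
    exact ⟨rfl, _, rfl, .left s, HEq.rfl⟩
  | right d ih =>
    cases N <;> cases hP
    obtain ⟨rfl, N', rfl, s, hs⟩ := ih rfl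
    obtain rfl := eq_of_heq hs
    exact ⟨rfl, _, rfl, .right s, HEq.rfl⟩
  | const d ih =>
    cases N <;> cases hP
    obtain ⟨rfl, N', rfl, s, hs⟩ := ih rfl
    obtain rfl := eq_of_heq hs
    exact ⟨rfl, _, rfl, .const s, HEq.rfl⟩
  | coopLeft h d ih => cases N <;> cases hP
  | coopRight h d ih => cases N <;> cases hP
  | coopSync h d e g ih ih' => cases N <;> cases hP

theorem stepOfSummand_bijective (σ : State IN IT) {N N' : Seq (Ed ⊕ Es) K} {a : Ed ⊕ Es} :
    Function.Bijective (M.stepOfSummand σ : Summand M.body N a N' → _) := by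
  refine ⟨stepOfSummand_injective σ, fun d => ?_⟩
  obtain ⟨-, N'', h, s, hs⟩ := exists_stepOfSummand d rfl
  obtain rfl := Seq.toTerm_injective h
  exact ⟨s, (eq_of_heq hs).symm⟩

/-- The process term that a mode of the TDSHA of a controller stands for. -/
def ctrlTerm (M : Model V IN IT Ed Es SN K) (C : Ctrl (Ed ⊕ Es) K) (q : (M.tdshaC C).Mode) :
    Term (Ed ⊕ Es) (Activity IN IT) (SN ⊕ K) :=
  (M.ctrlOf C q).toTerm (Activity IN IT) SN

theorem ctrlTerm_injective {C : Ctrl (Ed ⊕ Es) K} : Function.Injective (M.ctrlTerm C) := by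
  induction C with
  | seq N => exact fun q q' h => Subtype.ext (Seq.toTerm_injective h)
  | coop L C D ih ih' =>
    intro q q' h
    injection h with _ h h'
    exact Prod.ext (ih h) (ih' h')

theorem ctrlTerm_initMode (C : Ctrl (Ed ⊕ Es) K) :
    M.ctrlTerm C (M.tdshaC C).initMode = C.toTerm (Activity IN IT) SN := by
  induction C with
  | seq N => rfl
  | coop L C D ih ih' => exact congrArg₂ (Term.coop L) ih ih'

/-- Controllers leave the state unchanged and evolve into controllers. -/
theorem step_ctrlTerm {C : Ctrl (Ed ⊕ Es) K} {q : (M.tdshaC C).Mode} {σ σ' : State IN IT}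
    {a : Ed ⊕ Es} {P' : Term (Ed ⊕ Es) (Activity IN IT) (SN ⊕ K)}
    (h : Nonempty (Step M.env (M.ctrlTerm C q) σ a P' σ')) :
    σ' = σ ∧ a ∈ C.ev M.body ∧ ∃ q', P' = M.ctrlTerm C q' := by
  induction C generalizing P' σ' with
  | seq N =>
    obtain ⟨d⟩ := h
    obtain ⟨rfl, N', rfl, s, -⟩ := exists_stepOfSummand d rfl
    exact ⟨rfl, q.2.occurs (Seq.Occurs.of_summand (a := a) s).1, ⟨N', q.2.step ⟨s⟩⟩, rfl⟩
  | coop L C D ih ih' =>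
    rcases Step.coop_nonempty_iff.1 h with ⟨P', -, rfl, h₁⟩ | ⟨P', -, rfl, h₁⟩ |
      ⟨P', Q', τ, τ', -, rfl, h₁, h₂, g⟩
    · obtain ⟨rfl, ha, q', rfl⟩ := ih (q := q.1) h₁
      exact ⟨rfl, .inl ha, (q', q.2), rfl⟩
    · obtain ⟨rfl, ha, q', rfl⟩ := ih' (q := q.2) h₁
      exact ⟨rfl, .inr ha, (q.1, q'), rfl⟩
    · obtain ⟨rfl, ha, q₁, rfl⟩ := ih (q := q.1) h₁
      obtain ⟨rfl, -, q₂, rfl⟩ := ih' (q := q.2) h₂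
      exact ⟨Step.isGamma_right_iff.1 g, .inl ha, (q₁, q₂), rfl⟩

/-- Product transitions of modes and derivations of cooperating controllers agree; that a component
stays in its mode means that its term is unchanged. -/
theorem sync_equiv_step_ctrlTerm {L : Set (Ed ⊕ Es)} {C D : Ctrl (Ed ⊕ Es) K} (σ : State IN IT)
    (q : (M.tdshaC (.coop L C D)).Mode) (a : Ed ⊕ Es) (q' : (M.tdshaC (.coop L C D)).Mode) :
    Nonempty (Sync L a (Step M.env (M.ctrlTerm C q.1) σ a (M.ctrlTerm C q'.1) σ)
      (Step M.env (M.ctrlTerm D q.2) σ a (M.ctrlTerm D q'.2) σ) (q.2 = q'.2) (q.1 = q'.1) ≃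
        Step M.env (M.ctrlTerm (.coop L C D) q) σ a (M.ctrlTerm (.coop L C D) q') σ) := by
  by_cases ha : a ∈ L
  · obtain ⟨e⟩ := Step.coop_equiv_of_mem (env := M.env) (P := M.ctrlTerm C q.1)
      (P' := M.ctrlTerm C q'.1) (Q' := M.ctrlTerm D q'.2) (σ' := σ) ha
      (fun Q' τ (h : Nonempty (Step M.env (M.ctrlTerm D q.2) σ a Q' τ)) => (step_ctrlTerm h).1)
    exact ⟨(Sync.equivOfMem ha).trans e.symm⟩
  · obtain ⟨e⟩ := Step.coop_equiv_of_notMem (env := M.env) (P := M.ctrlTerm C q.1)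
      (P' := M.ctrlTerm C q'.1) (Q := M.ctrlTerm D q.2) (Q' := M.ctrlTerm D q'.2) (σ := σ)
      (σ' := σ) ha
    refine ⟨(Sync.equivOfNotMem ha).trans (Equiv.trans ?_ e.symm)⟩
    exact Equiv.sumCongr ((Equiv.refl _).subtypeEquiv fun _ => ctrlTerm_injective.eq_iff.symm)
      ((Equiv.refl _).subtypeEquiv fun _ => ctrlTerm_injective.eq_iff.symm)

theorem step_ctrlTerm_equiv {C : Ctrl (Ed ⊕ Es) K} (σ τ : State IN IT) (q q' : (M.tdshaC C).Mode)
    (a : Ed ⊕ Es) :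
    Nonempty (Step M.env (M.ctrlTerm C q) σ a (M.ctrlTerm C q') σ ≃
      Step M.env (M.ctrlTerm C q) τ a (M.ctrlTerm C q') τ) := by
  induction C with
  | seq N =>
    exact ⟨(Equiv.ofBijective _ (stepOfSummand_bijective σ)).symm.trans
      (Equiv.ofBijective _ (stepOfSummand_bijective τ))⟩
  | coop L C D ih ih' =>
    exact ⟨(sync_equiv_step_ctrlTerm σ q a q').some.symm.trans
      ((Sync.congr (ih _ _).some (ih' _ _).some).trans (sync_equiv_step_ctrlTerm τ q a q').some)⟩

/-- The guards of the TDSHA of a controller. -/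
def ctrlGuard (M : Model V IN IT Ed Es SN K) : Ed ⊕ Es → Set (V → ℝ) :=
  Sum.elim M.guard fun _ => Set.univ

/-- The transitions of the TDSHA of a controller are the derivations of the controller, in any
state. -/
theorem presented_tdshaC (C : Ctrl (Ed ⊕ Es) K) (σ : State IN IT) :
    (M.tdshaC C).Presented M.ctrlGuard M.R M.rate
      fun q a q' => Step M.env (M.ctrlTerm C q) σ a (M.ctrlTerm C q') σ := by
  induction C with
  | seq N =>
    refine TDSHA.Presented.congr (T := M.tdshaC (.seq N))
      (Tr := fun (q : {N' // SeqDs M.body N N'}) a (q' : {N' // SeqDs M.body N N'}) =>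
        Summand M.body q.1 a q'.1)
      ⟨?_, fun i => ⟨rfl, rfl, rfl⟩, fun q a q' => ⟨sigmaFiberEquiv
        (fun (q : {N' // SeqDs M.body N N'}) (a : Es) (q' : {N' // SeqDs M.body N N'}) =>
          Summand M.body q.1 (Sum.inr a) q'.1) q a q'⟩⟩
      fun q a q' => ⟨Equiv.ofBijective _ (stepOfSummand_bijective σ)⟩
    · rintro ⟨q, q', g, r, w, a⟩
      constructor
      · rintro ⟨q₁, q₂, b, hb, e⟩
        injection e with e1 e2 e3 e4 e5 e6
        subst e1 e2 e3 e4 e5 e6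
        exact ⟨hb, rfl, rfl, rfl⟩
      · rintro ⟨hb, hg, hr, hw⟩
        dsimp only at hg hr hw
        subst hg hr hw
        exact ⟨q, q', a, hb, rfl⟩
  | coop L C D ih ih' =>
    refine (ih.tprod ih' (fun _ _ _ _ _ => ⟨rfl, rfl⟩) (fun _ _ _ _ _ => ⟨rfl, rfl⟩)
      fun _ _ => ⟨Set.inter_self _, ?_⟩).congr (sync_equiv_step_ctrlTerm σ)
    simp [Reset.conj]

theorem isEmpty_flows_tdshaC (C : Ctrl (Ed ⊕ Es) K) : IsEmpty (M.tdshaC C).flows.Idx := by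
  induction C with
  | seq N => exact inferInstanceAs (IsEmpty PEmpty)
  | coop L C D ih ih' =>
    constructor
    rintro (i | i)
    · exact ih.elim i.1
    · exact ih'.elim i.2

theorem finite_mode_tdshaC [Finite K] (C : Ctrl (Ed ⊕ Es) K) : Finite (M.tdshaC C).Mode := by
  induction C with
  | seq N => exact SeqDs.finite M.body N
  | coop L C D ih ih' => exact @Finite.instProd _ _ ih ih'

theorem initReset_tdshaC (C : Ctrl (Ed ⊕ Es) K) :
    (M.tdshaC C).initReset = M.R (Sum.inl M.init) := by
  induction C with
  | seq N => rfl
  | coop L C D ih ih' =>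
    change ((M.tdshaC C).initReset).conj (M.tdshaC D).initReset = _
    simp [ih, ih', Reset.conj]

end Model

/-! ### Compatibility of the factors -/

namespace RExpr

variable {V : Type u}

/-- Positions grow at the head of the list, so the position at which an expression is read is a
suffix of the positions of its random values. -/
theorem suffix_of_mem_laws {θ : RExpr V} {p l : List ℕ}
    {μ : (V → ℝ) → (List ℕ → ℝ) → MeasureTheory.ProbabilityMeasure ℝ}
    (h : (l, μ) ∈ θ.laws p) : p <:+ l := by
  induction θ generalizing p with
  | var v => exact h.elim
  | app n f args ih =>
    obtain ⟨i, hi⟩ := Set.mem_iUnion.1 h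
    exact (List.suffix_cons _ _).trans (ih i hi)
  | rand n dist params ih =>
    rcases h with h | h
    · exact (Prod.mk.inj h).1 ▸ List.suffix_rfl
    · obtain ⟨i, hi⟩ := Set.mem_iUnion.1 h
      exact (List.suffix_cons _ _).trans (ih i hi)

/-- The positions of the random values of an expression are pairwise distinct. -/
theorem laws_unique {θ : RExpr V} {p l : List ℕ}
    {μ ν : (V → ℝ) → (List ℕ → ℝ) → MeasureTheory.ProbabilityMeasure ℝ}
    (hμ : (l, μ) ∈ θ.laws p) (hν : (l, ν) ∈ θ.laws p) : μ = ν := by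
  -- a position determines the argument in which it lies
  have arg {i j : ℕ} {p : List ℕ} (hi : (i :: p) <:+ l) (hj : (j :: p) <:+ l) : i = j :=
    (List.cons.inj ((List.suffix_of_suffix_length_le hi hj le_rfl).eq_of_length rfl)).1
  induction θ generalizing p with
  | var v => exact hμ.elim
  | app n f args ih =>
    obtain ⟨i, hi⟩ := Set.mem_iUnion.1 hμ
    obtain ⟨j, hj⟩ := Set.mem_iUnion.1 hν
    obtain rfl := Fin.ext (arg (suffix_of_mem_laws hi) (suffix_of_mem_laws hj))
    exact ih i hi hj
  | rand n dist params ih =>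
    have ne {i : ℕ} (hi : (i :: l) <:+ l) : False := by simpa using hi.length_le
    rcases hμ with hμ | hμ <;> rcases hν with hν | hν
    · exact (Prod.mk.inj hμ).2.trans (Prod.mk.inj hν).2.symm
    · obtain ⟨j, hj⟩ := Set.mem_iUnion.1 hν
      obtain rfl := (Prod.mk.inj hμ).1
      exact (ne (suffix_of_mem_laws hj)).elim
    · obtain ⟨j, hj⟩ := Set.mem_iUnion.1 hμ
      obtain rfl := (Prod.mk.inj hν).1
      exact (ne (suffix_of_mem_laws hj)).elim
    · obtain ⟨i, hi⟩ := Set.mem_iUnion.1 hμ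
      obtain ⟨j, hj⟩ := Set.mem_iUnion.1 hν
      obtain rfl := Fin.ext (arg (suffix_of_mem_laws hi) (suffix_of_mem_laws hj))
      exact ih i hi hj

end RExpr

namespace Reset

variable {X W : Type u}

theorem conj_self (R : Reset X W) : R.conj R = R := by
  simp [conj]

theorem tt_conj (R : Reset X W) : tt.conj R = R := by
  simp [conj, tt]

theorem consistent_tt : (tt : Reset X W).Consistent :=
  ⟨fun _ _ _ h => h.elim, fun _ _ _ h => h.elim⟩

end Reset

theorem TDSHA.Presented.resetCompatible {X Ed Es W : Type u} {T₁ T₂ : TDSHA X Ed Es W}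
    {G₁ G₂ : Ed ⊕ Es → Set (X → ℝ)} {Rs₁ Rs₂ : Ed ⊕ Es → Reset X W}
    {rt₁ rt₂ : Es → (X → ℝ) → NNReal} {Tr₁ : T₁.Mode → Ed ⊕ Es → T₁.Mode → Type v}
    {Tr₂ : T₂.Mode → Ed ⊕ Es → T₂.Mode → Type w}
    (h₁ : T₁.Presented G₁ Rs₁ rt₁ Tr₁) (h₂ : T₂.Presented G₂ Rs₂ rt₂ Tr₂)
    (h : ∀ a, ((Rs₁ a).conj (Rs₂ a)).Consistent) : T₁.ResetCompatible T₂ := by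
  constructor
  · intro δ₁ hδ₁ δ₂ hδ₂ he
    rw [((h₁.inst δ₁).1 hδ₁).2.2.1, ((h₂.inst δ₂).1 hδ₂).2.2.1, he]
    exact h _
  · intro i j he
    rw [(h₁.label i).2.1, (h₂.label j).2.1, he]
    exact h _

theorem TDSHA.Presented.isValid {X Ed Es W : Type u} [Fintype X] [Finite Ed] [Finite Es]
    {T : TDSHA X Ed Es W} {G : Ed ⊕ Es → Set (X → ℝ)} {Rs : Ed ⊕ Es → Reset X W}
    {rt : Es → (X → ℝ) → NNReal} {Tr : T.Mode → Ed ⊕ Es → T.Mode → Type v}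
    (h : T.Presented G Rs rt Tr) (hm : Finite T.Mode)
    (hl : ∀ i, ∃ C, LipschitzWith C (T.flows.elem i).fn) (hG : ∀ a, IsClosed (G a))
    (hr : ∀ a, IntegrableAlongCurves (rt a)) : T.IsValid where
  finite_modes := hm
  finite_events := inferInstance
  lipschitz := hl
  inst_closed δ hδ := ((h.inst δ).1 hδ).2.1 ▸ hG _
  weight_pos δ hδ := ((h.inst δ).1 hδ).2.2.2 ▸ one_pos
  stoch_closed i := (h.label i).1 ▸ hG _
  integrable i := (h.label i).2.2 ▸ hr _
  consistent i j he := by rw [(h.label i).2.2, (h.label j).2.2, he]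

namespace Model

variable {V IN IT Ed Es SN K : Type u} {M : Model V IN IT Ed Es SN K}

theorem consistent_R (a : Ed ⊕ Es) : (M.R a).Consistent := by
  constructor
  · rintro x f g ⟨θ, h, hf⟩ ⟨θ', h', hg⟩
    dsimp only at h h' hf hg
    obtain rfl := Option.some.inj (h.symm.trans h')
    exact hf.trans hg.symm
  · rintro w μ ν ⟨v, θ, l, μ', h, hl, e⟩ ⟨v', θ', l', ν', h', hl', e'⟩
    injection e with e1 e2
    injection e' with e1' e2'
    rw [e1] at e1'
    injection e1' with _ e3
    injection e3 with e3 e4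
    subst e3 e4
    obtain rfl := Option.some.inj (h.symm.trans h')
    obtain rfl := RExpr.laws_unique hl hl'
    exact e2.trans e2'.symm

theorem productsDefinedU {U : USys SN} (h : M.ProperU U) : M.ProductsDefinedU U := by
  induction U with
  | sub s => trivial
  | coop U U' ih ih' =>
    refine ⟨ih h.left, ih' h.right, (presented_tdshaU h.left).resetCompatible
      (presented_tdshaU h.right) fun a => ?_, ?_⟩
    · rw [Reset.conj_self]
      exact Reset.consistent_tt
    · rw [TDSHA.InitCompatible, initReset_tdshaU, initReset_tdshaU, Reset.conj_self]
      exact Reset.consistent_tt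

theorem productsDefinedC (C : Ctrl (Ed ⊕ Es) K) (σ : State IN IT) : M.ProductsDefinedC C := by
  induction C with
  | seq N => trivial
  | coop L C D ih ih' =>
    refine ⟨ih, ih', (presented_tdshaC C σ).resetCompatible (presented_tdshaC D σ) fun a => ?_, ?_⟩
    · rw [Reset.conj_self]
      exact consistent_R a
    · rw [TDSHA.InitCompatible, initReset_tdshaC, initReset_tdshaC, Reset.conj_self]
      exact consistent_R _

theorem lipschitz_flowFn [Fintype V] (hM : M.Regular) (r : ℝ) (I : IT) :
    ∃ C, LipschitzWith C (M.flowFn r I) := by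
  obtain ⟨C, hC⟩ := hM.lipschitz I
  exact ⟨_, (lipschitzWith_smul r).comp hC⟩

theorem isClosed_ctrlGuard [Fintype V] (hM : M.Regular) (a : Ed ⊕ Es) :
    IsClosed (M.ctrlGuard a) := by
  rcases a with a | a
  · exact hM.closed a
  · exact isClosed_univ

/-! ### Controlled systems -/

namespace WellDefined

theorem properU (hM : M.WellDefined) : M.ProperU M.sys where
  nodup := by
    refine hM.nodup.map_on fun s hs s' hs' e => ?_
    exact (hM.infl (M.sub s').infl).unique ⟨hs, e⟩ ⟨hs', rfl⟩
  events s hs := by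
    have e : ((M.sub s).prefixes (Sum.inl M.init)).map Prod.fst =
        (M.sub s).branches.map Prod.fst ++ [Sum.inl M.init] := by
      simp [Subcomp.prefixes, Function.comp_def]
    rw [e]
    exact List.nodup_append.2 ⟨hM.distinct s hs, List.nodup_singleton _, fun a ha b hb hab =>
      hM.ne_init s hs (by rw [← List.mem_singleton.1 hb, ← hab]; exact ha)⟩

theorem mem_names (hM : M.WellDefined) (x : IN) : x ∈ M.names M.sys := by
  obtain ⟨s, ⟨hs, rfl⟩, -⟩ := hM.infl x
  exact List.mem_map.2 ⟨s, hs, rfl⟩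

theorem mem_syncSet_of_uev (hM : M.WellDefined) {a : Ed ⊕ Es} (h : a ∈ M.uev M.sys) :
    a ∈ M.syncSet :=
  ⟨h, hM.events ▸ h⟩

theorem mem_syncSet_of_ev (hM : M.WellDefined) {a : Ed ⊕ Es} (h : a ∈ M.con.ev M.body) :
    a ∈ M.syncSet :=
  ⟨hM.events.symm ▸ .inr h, .inr h⟩

/-- The transitions of the compositional mapping. Only synchronised ones occur, so all of them take
guard and reset from the controller. -/
theorem presented_tdshaComp (hM : M.WellDefined) (σ : State IN IT) :
    M.tdshaComp.Presented M.ctrlGuard M.R M.rate fun q a q' =>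
      Sync M.syncSet a (PLift (M.ModeStep M.sys q.1 a q'.1))
        (Step M.env (M.ctrlTerm M.con q.2) σ a (M.ctrlTerm M.con q'.2) σ)
        (q.2 = q'.2) (q.1 = q'.1) := by
  refine (presented_tdshaU hM.properU).tprod (presented_tdshaC M.con σ) ?_ ?_ ?_
  · rintro a ha q q' ⟨h⟩
    exact (ha (hM.mem_syncSet_of_uev h.1.1)).elim
  · rintro a ha q q' h
    exact (ha (hM.mem_syncSet_of_ev (step_ctrlTerm h).2.1)).elim
  · exact fun a _ => ⟨Set.univ_inter _, Reset.tt_conj _⟩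

theorem flowsBy_tdshaComp (hM : M.WellDefined) :
    M.tdshaComp.FlowsBy IN (fun x => unitVec (M.iv x)) fun q x =>
      (M.modeVal M.sys q.1 x).elim 0 fun p => M.flowFn p.1 p.2 := by
  obtain ⟨nm, h1, h2⟩ := flows_tdshaU hM.properU
  have := isEmpty_flows_tdshaC (M := M) M.con
  refine ⟨Sum.elim (fun i => nm i.1) fun i => isEmptyElim i.2, ?_, ?_⟩
  · rintro (⟨i, q⟩ | ⟨q, i⟩)
    · obtain ⟨p, hp, hv, hf⟩ := h1 i
      refine ⟨hv, hf.trans ?_⟩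
      exact (congrArg (fun o => Option.elim o 0 fun p => M.flowFn p.1 p.2) hp).symm
    · exact isEmptyElim i
  · rintro ⟨q₁, q₂⟩ x
    obtain ⟨i, ⟨hi, hi'⟩, hu⟩ := h2 q₁ x (hM.mem_names x)
    refine ⟨.inl (i, q₂), ⟨Prod.ext hi rfl, hi'⟩, ?_⟩
    rintro (⟨j, q⟩ | ⟨q, j⟩) ⟨hj, hj'⟩
    · obtain rfl := hu j ⟨congrArg Prod.fst hj, hj'⟩
      obtain rfl : q = q₂ := congrArg Prod.snd hj
      rfl
    · exact isEmptyElim j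

end WellDefined

theorem presented_tdshaSOS {c₀ : M.Config} (h₀ : M.IsInitial c₀) :
    (M.tdshaSOS c₀ h₀).Presented M.ctrlGuard M.R M.rate fun c a c' => M.Trans c.1 a c'.1 := by
  refine ⟨?_, fun i => ⟨rfl, rfl, rfl⟩, fun q a q' => ⟨sigmaFiberEquiv
    (fun (c : {c : M.Config // M.Ds c}) (a : Es) (c' : {c : M.Config // M.Ds c}) =>
      M.Trans c.1 (Sum.inr a) c'.1) q a q'⟩⟩
  · rintro ⟨q, q', g, r, w, a⟩
    constructor
    · rintro ⟨q₁, q₂, b, hb, e⟩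
      injection e with e1 e2 e3 e4 e5 e6
      subst e1 e2 e3 e4 e5 e6
      exact ⟨hb, rfl, rfl, rfl⟩
    · rintro ⟨hb, hg, hr, hw⟩
      dsimp only at hg hr hw
      subst hg hr hw
      exact ⟨q, q', a, hb, rfl⟩

theorem flowsBy_tdshaSOS {c₀ : M.Config} (h₀ : M.IsInitial c₀) :
    (M.tdshaSOS c₀ h₀).FlowsBy IN (fun x => unitVec (M.iv x)) fun c x =>
      M.flowFn (c.1.2 x).1 (c.1.2 x).2 :=
  ⟨Prod.snd, fun _ => ⟨rfl, rfl⟩, fun q x => ⟨(q, x), ⟨rfl, rfl⟩, fun _ h => Prod.ext h.1 h.2⟩⟩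

/-- The configuration `c` and the mode `q` stand for each other. This is `Matches`, with activities
replaced by the values of influences. -/
def Corresponds (M : Model V IN IT Ed Es SN K) (c : M.Config) (q : M.tdshaComp.Mode) : Prop :=
  c.1 = .coop M.syncSet (M.uterm M.sys) (M.ctrlTerm M.con q.2) ∧
  ∀ x, M.modeVal M.sys q.1 x = some (c.2 x)

namespace Corresponds

theorem toMatches (hM : M.WellDefined) {c : M.Config} {q : M.tdshaComp.Mode}
    (h : M.Corresponds c q) : M.Matches c q := by
  refine ⟨h.1, fun x r I => ?_⟩
  rw [active_iff hM.properU, h.2, Option.some_inj]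

theorem right_unique (hM : M.WellDefined) {c : M.Config} {q q' : M.tdshaComp.Mode}
    (h : M.Corresponds c q) (h' : M.Corresponds c q') : q = q' := by
  have e := h.1.symm.trans h'.1
  injection e with _ _ e
  exact Prod.ext (modeVal_injective hM.properU fun x => (h.2 x).trans (h'.2 x).symm)
    (ctrlTerm_injective e)

theorem left_unique {c c' : M.Config} {q : M.tdshaComp.Mode}
    (h : M.Corresponds c q) (h' : M.Corresponds c' q) : c = c' :=
  Prod.ext (h.1.trans h'.1.symm)
    (funext fun x => Option.some.inj ((h.2 x).symm.trans (h'.2 x)))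

/-- On corresponding states, a mode step is the overwriting that the derivations of the uncontrolled
system perform. -/
theorem modeStep_iff {c c' : M.Config} {q q' : M.tdshaComp.Mode} (h : M.Corresponds c q)
    (h' : M.Corresponds c' q') {a : Ed ⊕ Es} :
    M.ModeStep M.sys q.1 a q'.1 ↔
      a ∈ M.uev M.sys ∧ ∀ x, c'.2 x = (M.newVal M.sys a x).getD (c.2 x) := by
  refine and_congr_right fun _ => forall_congr' fun x => ?_
  rw [h.2, h'.2]
  cases M.newVal M.sys a x <;> simp

/-- Corresponding configurations and modes have the same number of transitions. Controllers behave
in the same way in all states, so the state `σ` for the controller can be chosen at will. -/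
theorem trans_equiv (hM : M.WellDefined) {c c' : M.Config} {q q' : M.tdshaComp.Mode}
    (h : M.Corresponds c q) (h' : M.Corresponds c' q') (σ : State IN IT) (a : Ed ⊕ Es) :
    Nonempty (M.Trans c a c' ≃ Sync M.syncSet a (PLift (M.ModeStep M.sys q.1 a q'.1))
      (Step M.env (M.ctrlTerm M.con q.2) σ a (M.ctrlTerm M.con q'.2) σ)
      (q.2 = q'.2) (q.1 = q'.1)) := by
  have key := h.modeStep_iff h' (a := a)
  obtain ⟨P, τ⟩ := c
  obtain ⟨P', τ'⟩ := c'
  obtain rfl := h.1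
  obtain rfl := h'.1
  dsimp only at key
  obtain ⟨e⟩ : Nonempty (Step M.env (M.uterm M.sys) τ a (M.uterm M.sys) τ' ≃
      PLift (M.ModeStep M.sys q.1 a q'.1)) := by
    have := step_uterm_subsingleton hM.properU (σ := τ) (σ' := τ') (a := a) (P' := M.uterm M.sys)
    refine nonempty_equiv_of_subsingleton ?_
    rw [step_uterm_iff hM.properU, nonempty_plift, nonempty_prop, key]
    exact and_iff_right rfl
  by_cases ha : a ∈ M.syncSet
  · obtain ⟨f⟩ := Step.coop_equiv_of_mem (env := M.env) (P := M.uterm M.sys)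
      (P' := M.uterm M.sys) (Q' := M.ctrlTerm M.con q'.2) (σ' := τ') ha
      (fun Q' υ (h : Nonempty (Step M.env (M.ctrlTerm M.con q.2) τ a Q' υ)) => (step_ctrlTerm h).1)
    exact ⟨f.trans ((Equiv.prodCongr e (step_ctrlTerm_equiv τ σ q.2 q'.2 a).some).trans
      (Sync.equivOfMem ha).symm)⟩
  · -- neither side can perform an event that is not synchronised
    have hU (P' υ) : IsEmpty (Step M.env (M.uterm M.sys) τ a P' υ) :=
      ⟨fun d => ha (hM.mem_syncSet_of_uev ((step_uterm_iff hM.properU).1 ⟨d⟩).2.1)⟩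
    have hC (υ υ' Q') : IsEmpty (Step M.env (M.ctrlTerm M.con q.2) υ a Q' υ') :=
      ⟨fun d => ha (hM.mem_syncSet_of_ev (step_ctrlTerm ⟨d⟩).2.1)⟩
    have : IsEmpty (PLift (M.ModeStep M.sys q.1 a q'.1)) := e.symm.isEmpty
    obtain ⟨f⟩ := Step.coop_equiv_of_notMem (env := M.env) (P := M.uterm M.sys)
      (P' := M.uterm M.sys) (Q := M.ctrlTerm M.con q.2) (Q' := M.ctrlTerm M.con q'.2) (σ := τ)
      (σ' := τ') ha
    have := f.isEmpty
    have := (Sync.equivOfNotMem ha (A := PLift (M.ModeStep M.sys q.1 a q'.1))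
      (B := Step M.env (M.ctrlTerm M.con q.2) σ a (M.ctrlTerm M.con q'.2) σ)
      (p := q.2 = q'.2) (q := q.1 = q'.1)).isEmpty
    exact ⟨Equiv.equivOfIsEmpty _ _⟩

theorem forth (hM : M.WellDefined) {c c' : M.Config} {q : M.tdshaComp.Mode} {a : Ed ⊕ Es}
    (h : M.Corresponds c q) (ht : Nonempty (M.Trans c a c')) : ∃ q', M.Corresponds c' q' := by
  obtain ⟨P, τ⟩ := c
  obtain ⟨P', τ'⟩ := c'
  obtain rfl := h.1
  rcases Step.coop_nonempty_iff.1 ht with ⟨P', ha, -, h₁⟩ | ⟨P', ha, -, h₁⟩ |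
      ⟨P', Q', υ, υ', -, e, h₁, h₂, g⟩
  · exact (ha (hM.mem_syncSet_of_uev ((step_uterm_iff hM.properU).1 h₁).2.1)).elim
  · exact (ha (hM.mem_syncSet_of_ev (step_ctrlTerm h₁).2.1)).elim
  · obtain ⟨rfl, -, hυ⟩ := (step_uterm_iff hM.properU).1 h₁
    obtain ⟨rfl, -, q₂, rfl⟩ := step_ctrlTerm h₂
    obtain rfl := Step.isGamma_right_iff.1 g
    obtain ⟨q₁, hq₁⟩ := exists_modeVal_eq hM.properU a q.1
    refine ⟨(q₁, q₂), e, fun x => ?_⟩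
    rw [hq₁, h.2]
    dsimp only at hυ ⊢
    rw [hυ]
    cases M.newVal M.sys a x <;> rfl

end Corresponds

/-- As every influence belongs to a subcomponent, the modes of the TDSHA of the uncontrolled system
are states. -/
theorem WellDefined.exists_state (hM : M.WellDefined) (q : (M.tdshaU M.sys).Mode) :
    ∃ σ : State IN IT, ∀ x, M.modeVal M.sys q x = some (σ x) := by
  choose σ hσ using fun x => Option.ne_none_iff_exists'.1
    (modeVal_ne_none_iff (q := q).2 (hM.mem_names x))
  exact ⟨σ, hσ⟩

/-- The initial event sets all influences, hence leads to one configuration from all states. -/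
theorem WellDefined.exists_isInitial (hM : M.WellDefined) :
    ∃ c₀ : M.Config, M.IsInitial c₀ ∧ M.Corresponds c₀ M.tdshaComp.initMode := by
  obtain ⟨σ₀, hσ₀⟩ := hM.exists_state (M.tdshaU M.sys).initMode
  refine ⟨(.coop M.syncSet (M.uterm M.sys) (M.ctrlTerm M.con (M.tdshaC M.con).initMode), σ₀),
    fun σ c => ?_, rfl, hσ₀⟩
  have hi : Sum.inl M.init ∈ M.syncSet := hM.mem_syncSet_of_uev (init_mem_uev M.sys)
  have hn (x) : (M.newVal M.sys (Sum.inl M.init) x).getD (σ x) = σ₀ x := by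
    rw [← modeVal_initMode hM.properU, hσ₀]
    rfl
  obtain ⟨P', σ'⟩ := c
  rw [ctrlTerm_initMode, Prod.mk.injEq]
  refine Step.coop_nonempty_iff.trans ⟨?_, ?_⟩
  · rintro (⟨P', ha, -, h₁⟩ | ⟨P', ha, -, h₁⟩ | ⟨P', Q', υ, υ', -, e, h₁, ⟨d⟩, g⟩)
    · exact (ha hi).elim
    · exact (ha hi).elim
    · obtain ⟨rfl, -, hυ⟩ := (step_uterm_iff hM.properU).1 h₁
      cases d
      obtain rfl := Step.isGamma_right_iff.1 g
      exact ⟨e, funext fun x => (hυ x).trans (hn x)⟩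
  · rintro ⟨rfl, rfl⟩
    exact .inr (.inr ⟨_, _, σ', σ, hi, rfl, (step_uterm_iff hM.properU).2
      ⟨rfl, init_mem_uev M.sys, fun x => (hn x).symm⟩, ⟨.pre⟩, Step.isGamma_right_iff.2 rfl⟩)

theorem WellDefined.exists_corresponds (hM : M.WellDefined) {c₀ : M.Config} (h₀ : M.IsInitial c₀)
    (h : M.Corresponds c₀ M.tdshaComp.initMode) {c : M.Config} (hc : M.Ds c) :
    ∃ q, M.Corresponds c q := by
  induction hc with
  | init ht =>
    obtain rfl := (h₀ _ _).1 ht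
    exact ⟨_, h⟩
  | step _ ht ih =>
    obtain ⟨q, hq⟩ := ih
    exact hq.forth hM ht

theorem WellDefined.productsDefined (hM : M.WellDefined) (σ : State IN IT) :
    M.ProductsDefined := by
  refine ⟨productsDefinedU hM.properU, productsDefinedC M.con σ,
    (presented_tdshaU hM.properU).resetCompatible (presented_tdshaC M.con σ) fun a => ?_, ?_⟩
  · rw [Reset.tt_conj]
    exact consistent_R a
  · rw [TDSHA.InitCompatible, initReset_tdshaU, initReset_tdshaC, Reset.tt_conj]
    exact consistent_R _

theorem WellDefined.exists_iso (hM : M.WellDefined) {c₀ : M.Config} (h₀ : M.IsInitial c₀)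
    (h : M.Corresponds c₀ M.tdshaComp.initMode) :
    ∃ ρ : (M.tdshaSOS c₀ h₀).prune.Iso M.tdshaComp.prune,
      ∀ q : (M.tdshaSOS c₀ h₀).prune.Mode, M.Corresponds q.1.1 (ρ.modes q).1 := by
  refine (presented_tdshaSOS h₀).exists_prune_iso (hM.presented_tdshaComp c₀.2)
    (flowsBy_tdshaSOS h₀) hM.flowsBy_tdshaComp (fun c q => M.Corresponds c.1 q)
    (fun c q q' hc hc' => hc.right_unique hM hc')
    (fun c c' q hc hc' => Subtype.ext (hc.left_unique hc')) h ?_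
    (fun c q a c' hc ht => hc.forth hM ht) ?_
    (fun c q c' q' a hc hc' => hc.trans_equiv hM hc' c₀.2 a) fun c q x hc => ?_
  · change _ = (M.tdshaU M.sys).initReset.conj (M.tdshaC M.con).initReset
    rw [initReset_tdshaU, initReset_tdshaC, Reset.tt_conj]
    rfl
  · intro c q a q' hc ht
    obtain ⟨σ', hσ'⟩ := hM.exists_state q'.1
    let c' : M.Config := (.coop M.syncSet (M.uterm M.sys) (M.ctrlTerm M.con q'.2), σ')
    have hc' : M.Corresponds c' q' := ⟨rfl, hσ'⟩
    exact ⟨⟨c', c.2.step ((hc.trans_equiv hM hc' c₀.2 a).some.nonempty_congr.2 ht)⟩, hc'⟩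
  · rw [hc.2]
    rfl

theorem WellDefined.isValid [Fintype V] [Finite Ed] [Finite Es] [Finite K] (hM : M.WellDefined)
    {c₀ : M.Config} (h₀ : M.IsInitial c₀) (h : M.Corresponds c₀ M.tdshaComp.initMode)
    (hR : M.Regular) : (M.tdshaSOS c₀ h₀).IsValid ∧ M.tdshaComp.IsValid := by
  have hfin : Finite M.tdshaComp.Mode :=
    @Finite.instProd _ _ (finite_mode_tdshaU M.sys) (finite_mode_tdshaC M.con)
  have hfin' : Finite (M.tdshaSOS c₀ h₀).Mode := by
    choose f hf using fun c : {c : M.Config // M.Ds c} => hM.exists_corresponds h₀ h c.2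
    exact Finite.of_injective f fun c c' e =>
      Subtype.ext ((hf c).left_unique (e ▸ hf c'))
  refine ⟨(presented_tdshaSOS h₀).isValid hfin' (fun i => lipschitz_flowFn hR _ _)
    (isClosed_ctrlGuard hR) hR.integrable,
    (hM.presented_tdshaComp c₀.2).isValid hfin (fun i => ?_) (isClosed_ctrlGuard hR) hR.integrable⟩
  obtain ⟨nm, hl, -⟩ := hM.flowsBy_tdshaComp
  obtain ⟨σ, hσ⟩ := hM.exists_state (M.tdshaComp.flows.elem i).mode.1
  have e := (hl i).2.trans
    (congrArg (fun o => Option.elim o 0 fun p => M.flowFn p.1 p.2) (hσ (nm i)))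
  rw [e]
  exact lipschitz_flowFn hR _ _

end Model

end

end SHYPE

theorem mainTheorem5 {V IN IT Ed Es SN K : Type u} [Fintype V] [Finite Ed] [Finite Es] [Finite K]
    (M : SHYPE.Model V IN IT Ed Es SN K) (hM : M.WellDefined) :
    M.ProductsDefined ∧
    ∃ (c₀ : M.Config) (h₀ : M.IsInitial c₀),
      (∃ ρ : (M.tdshaSOS c₀ h₀).prune.Iso M.tdshaComp.prune,
        ∀ q : (M.tdshaSOS c₀ h₀).prune.Mode, M.Matches q.1.1 (ρ.modes q).1) ∧
      (M.Regular → (M.tdshaSOS c₀ h₀).IsValid ∧ M.tdshaComp.IsValid) := by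
  obtain ⟨c₀, h₀, h⟩ := hM.exists_isInitial
  obtain ⟨ρ, hρ⟩ := hM.exists_iso h₀ h
  exact ⟨hM.productsDefined c₀.2, c₀, h₀,
    ⟨ρ, fun q => SHYPE.Model.Corresponds.toMatches hM (hρ q)⟩, hM.isValid h₀ h⟩
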